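/- Let $\mathbb F$ be a field of characteristic not equal to $2$, and let $\alpha,\beta\in\mathbb F\setminus\{0,1\}$ with $\alpha\neq\beta$. All algebras are commutative $\mathbb F$-algebras, not necessarily associative or unital. For an element $a$ of an algebra $A$ let $A_\lambda(a)=\{x\in A: ax=\lambda x\}$ and $A_S(a)=\bigoplus_{\lambda\in S}A_\lambda(a)$. For a fusion law $\star:\mathcal F\times\mathcal F\to 2^{\mathcal F}$ on a set $\mathcal F\subseteq\mathbb F$, a (primitive) $\mathcal F$-axis of $A$ is an idempotent $a\in A$ with $A=A_{\mathcal F}(a)$, $A_\lambda(a)A_\mu(a)\subseteq A_{\lambda\star\mu}(a)$ for all $\lambda,\mu\in\mathcal F$, and $A_1(a)=\mathbb F a$. The fusion laws used are symmetric: $\mathcal M(\alpha,\beta)$ on $\{0,1,\alpha,\beta\}$, with $0\star0=\{0\}$, $1\star1=\{1\}$, $0\star1=\emptyset$, $0\star\alpha=1\star\alpha=\{\alpha\}$, $0\star\beta=1\star\beta=\alpha\star\beta=\{\beta\}$, $\alpha\star\alpha=\{0,1\}$, $\beta\star\beta=\{0,1,\alpha\}$; and $\mathcal J(\alpha)$,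 its restriction to $\{0,1,\alpha\}$. Suppose that $A$ is generated as an algebra by two elements $p,q$ such that $p$ is a primitive $\mathcal M(\alpha,\beta)$-axis and $q$ is a primitive $\mathcal J(\alpha)$-axis of $A$. Then one of the following holds. 1. $A$ is an axial algebra of Jordan type $\mathcal J(\alpha)$ with respect to the generating set $\{p,q\}$; that is, $p$ is also a primitive $\mathcal J(\alpha)$-axis. 2. $\alpha\neq\frac12$, $\alpha+\beta=1$ and $A\cong 3\mathrm C(\alpha,1-\alpha)$. 3. $\operatorname{char}\mathbb F\neq3$, $(\alpha,\beta)=(\frac13,\frac23)$, and either $\operatorname{char}\mathbb F\neq5$ and $A\cong Q_2(\frac13,\frac23)$, or $\operatorname{char}\mathbb F=5$ and $A\cong Q_2(\frac13)^\times\oplus\langle\mathbb 1\rangle$. In 2 and 3 the isomorphism of algebras can be chosen to map $p,q$, in this order, to the two axes given for the listed algebra: - $3\mathrm C(\eta)$ has a basis of three idempotents $x,y,z$ with $xy=\frac\eta2(x+y-z)$, $xz=\frac\eta2(x+z-y)$, $yz=\frac\eta2(y+z-x)$, and, for $\eta\neq-1$, the identity $\mathbb 1=\frac1{\eta+1}(x+y+z)$.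 If $\alpha\neq-1$, then $3\mathrm C(\alpha,1-\alpha)$ is $3\mathrm C(\alpha)$ with the axes $\mathbb 1-x$ and $y$; moreover, $3\mathrm C(-1,2)$ is $3\mathrm C(2)$ with the axes $z$ and $\mathbb 1-x$. - $Q_2(\frac13,\frac23)$ has a basis of four idempotents $s_1,s_2,d_1,d_2$ with $s_1s_2=0$, $s_id_1=\frac13s_i+\frac16d_1-\frac16d_2$ and $s_id_2=\frac13s_i-\frac16d_1+\frac16d_2$ for $i=1,2$, and $d_1d_2=\frac13(d_1+d_2-s_1-s_2)$. In characteristic not $5$ it has the identity $\mathbb 1=\frac35(s_1+s_2+d_1+d_2)$, and its axes are $\mathbb 1-d_1$ and $s_1$. - $Q_2(\frac13)^\times\oplus\langle\mathbb 1\rangle$ (in characteristic $5$) has a basis of idempotents $x,y,z,\mathbb 1$, where $\mathbb 1$ is the identity, $xy=0$, $xz=3x+y+2z$ and $yz=x+3y+2z$; its axes are $\mathbb 1-z$ and $x$. -/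

import Mathlib

namespace Axial

universe u v w

/-! ## Fusion laws -/

/-- A fusion law with values in `F`: a set `carrier ⊆ F` and a binary operation `star` with values
in the subsets of `F`. Only the values of `star` on `carrier` are ever used. -/
structure FusionLaw (F : Type u) where
  carrier : Set F
  star : F → F → Set F

open Classical in
/-- The Jordan fusion law `J(η)` on `{0, 1, η}`:

    ⋆ | 0   1   η
    0 | 0       η
    1 |     1   η
    η | η   η   1,0
-/
noncomputable def jordanLaw {F : Type u} [Field F] (η : F) : FusionLaw F where
  carrier := {0, 1, η}
  star x y :=
    if x = 0 then (if y = 1 then ∅ else {y})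
    else if x = 1 then (if y = 0 then ∅ else {y})
    else (if y = 0 ∨ y = 1 then {η} else {1, 0})

open Classical in
/-- The Monster fusion law `M(α, β)` on `{0, 1, α, β}`:

    ⋆ | 0   1   α    β
    0 | 0       α    β
    1 |     1   α    β
    α | α   α   1,0  β
    β | β   β   β    1,0,α
-/
noncomputable def monsterLaw {F : Type u} [Field F] (α β : F) : FusionLaw F where
  carrier := {0, 1, α, β}
  star x y :=
    if x = 0 then (if y = 1 then ∅ else {y})
    else if x = 1 then (if y = 0 then ∅ else {y})
    else if x = α then (if y = 0 ∨ y = 1 then {α} else if y = α then {1, 0} else {β})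
    else (if y = β then {1, 0, α} else {β})

/-! ## Axes and axial algebras -/

section Axes

variable (F : Type u) [Field F] {A : Type v} [NonUnitalNonAssocCommRing A] [Module F A]
  [IsScalarTower F A A] [SMulCommClass F A A]

/-- The `t`-eigenspace `A_t(a)` of the adjoint map `x ↦ a * x`. -/
def axisSpace (a : A) (t : F) : Submodule F A :=
  Module.End.eigenspace (LinearMap.mulLeft F a) t

/-- `A_S(a)`, the sum of the eigenspaces `A_t(a)` with `t ∈ S`. -/
def axisSum (a : A) (S : Set F) : Submodule F A := ⨆ t ∈ S, axisSpace F a t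

variable {F}

/-- `a` is a (primitive) axis for the fusion law `L`. -/
structure IsAxis (L : FusionLaw F) (a : A) : Prop where
  idem : a * a = a
  semisimple : axisSum F a L.carrier = ⊤
  fusion : ∀ s ∈ L.carrier, ∀ t ∈ L.carrier, ∀ x ∈ axisSpace F a s, ∀ y ∈ axisSpace F a t,
    x * y ∈ axisSum F a (L.star s t)
  primitive : axisSpace F a 1 = Submodule.span F {a}

/-- `(A, X)` is a (primitive) axial algebra for the fusion law `L`: every element of `X` is an
`L`-axis and `X` generates `A` as a (nonunital) algebra. -/
structure IsAxialAlgebra (L : FusionLaw F) (X : Set A) : Prop where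
  axes : ∀ a ∈ X, IsAxis L a
  generates : NonUnitalAlgebra.adjoin F X = ⊤

end Axes

/-! ## Algebras given by a multiplication table -/

/-- The `n`-dimensional algebra over `F` with basis `e 0, …, e (n - 1)` and multiplication
`e i * e j = ∑ k, c i j k • e k`. -/
def TableAlgebra {F : Type u} {n : ℕ} (_c : Fin n → Fin n → Fin n → F) : Type u := Fin n → F

namespace TableAlgebra

variable {F : Type u} [Field F] {n : ℕ} (c : Fin n → Fin n → Fin n → F)

instance : AddCommGroup (TableAlgebra c) := inferInstanceAs (AddCommGroup (Fin n → F))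

instance : Module F (TableAlgebra c) := inferInstanceAs (Module F (Fin n → F))

instance : Mul (TableAlgebra c) where
  mul x y := fun k => ∑ i, ∑ j, x i * y j * c i j k

theorem add_apply (x y : TableAlgebra c) (k : Fin n) : (x + y) k = x k + y k := rfl

theorem sub_apply (x y : TableAlgebra c) (k : Fin n) : (x - y) k = x k - y k := rfl

theorem smul_apply (r : F) (x : TableAlgebra c) (k : Fin n) : (r • x) k = r * x k := rfl

theorem mul_apply (x y : TableAlgebra c) (k : Fin n) :
    (x * y) k = ∑ i, ∑ j, x i * y j * c i j k := rfl

instance : NonUnitalNonAssocRing (TableAlgebra c) where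
  __ := (inferInstance : AddCommGroup (TableAlgebra c))
  __ := (inferInstance : Mul (TableAlgebra c))
  left_distrib x y z := by
    funext k
    simp only [mul_apply, add_apply, mul_add, add_mul, Finset.sum_add_distrib]
  right_distrib x y z := by
    funext k
    simp only [mul_apply, add_apply, add_mul, Finset.sum_add_distrib]
  zero_mul x := by
    funext k
    change ∑ i, ∑ j, (0 : F) * x j * c i j k = 0
    simp
  mul_zero x := by
    funext k
    change ∑ i, ∑ j, x i * (0 : F) * c i j k = 0
    simp

/-- The `i`-th basis element. -/
def e (i : Fin n) : TableAlgebra c := fun j => if j = i then 1 else 0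

theorem e_apply (i j : Fin n) : e c i j = if j = i then 1 else 0 := rfl

end TableAlgebra

open TableAlgebra

section Examples

variable (F : Type u) [Field F]

/-! ### The three-dimensional algebra `3C(η)` -/

/-- Multiplication of `3C(η)` in the basis `x, y, z`: these are idempotents, and the product of two
distinct ones is `η / 2` times (their sum minus the third). -/
def threeCTable (η : F) : Fin 3 → Fin 3 → Fin 3 → F :=
  ![![![1, 0, 0], ![η / 2, η / 2, -(η / 2)], ![η / 2, -(η / 2), η / 2]],
    ![![η / 2, η / 2, -(η / 2)], ![0, 1, 0], ![-(η / 2), η / 2, η / 2]],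
    ![![η / 2, -(η / 2), η / 2], ![-(η / 2), η / 2, η / 2], ![0, 0, 1]]]

/-- The algebra `3C(η)`. -/
abbrev ThreeC (η : F) : Type u := TableAlgebra (threeCTable F η)

/-- The identity element `(x + y + z) / (η + 1)` of `3C(η)`, for `η ≠ -1`. -/
def threeCOne (η : F) : ThreeC F η :=
  (1 / (η + 1)) • (e (threeCTable F η) 0 + e (threeCTable F η) 1 + e (threeCTable F η) 2)

/-! ### The four-dimensional algebra `Q₂(1/3)` -/

/-- Multiplication of `Q₂(1/3)` in the basis `s₁, s₂, d₁, d₂`. -/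
def qTable : Fin 4 → Fin 4 → Fin 4 → F :=
  ![![![1, 0, 0, 0], ![0, 0, 0, 0], ![1 / 3, 0, 1 / 6, -(1 / 6)], ![1 / 3, 0, -(1 / 6), 1 / 6]],
    ![![0, 0, 0, 0], ![0, 1, 0, 0], ![0, 1 / 3, 1 / 6, -(1 / 6)], ![0, 1 / 3, -(1 / 6), 1 / 6]],
    ![![1 / 3, 0, 1 / 6, -(1 / 6)], ![0, 1 / 3, 1 / 6, -(1 / 6)], ![0, 0, 1, 0],
      ![-(1 / 3), -(1 / 3), 1 / 3, 1 / 3]],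
    ![![1 / 3, 0, -(1 / 6), 1 / 6], ![0, 1 / 3, -(1 / 6), 1 / 6],
      ![-(1 / 3), -(1 / 3), 1 / 3, 1 / 3], ![0, 0, 0, 1]]]

/-- The algebra `Q₂(1/3)` (over a field of characteristic not `3`). -/
abbrev Q : Type u := TableAlgebra (qTable F)

/-- The identity element `(3 / 5) (s₁ + s₂ + d₁ + d₂)` of `Q₂(1/3)` in characteristic not `5`. -/
def qOne : Q F :=
  (3 / 5 : F) • (e (qTable F) 0 + e (qTable F) 1 + e (qTable F) 2 + e (qTable F) 3)

/-! ### The four-dimensional algebra `Q₂(1/3)ˣ ⊕ ⟨𝟙⟩` in characteristic `5` -/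

/-- Multiplication of `Q₂(1/3)ˣ ⊕ ⟨𝟙⟩` in the basis `x, y, z, 𝟙`. -/
def qxTable : Fin 4 → Fin 4 → Fin 4 → F :=
  ![![![1, 0, 0, 0], ![0, 0, 0, 0], ![3, 1, 2, 0], ![1, 0, 0, 0]],
    ![![0, 0, 0, 0], ![0, 1, 0, 0], ![1, 3, 2, 0], ![0, 1, 0, 0]],
    ![![3, 1, 2, 0], ![1, 3, 2, 0], ![0, 0, 1, 0], ![0, 0, 1, 0]],
    ![![1, 0, 0, 0], ![0, 1, 0, 0], ![0, 0, 1, 0], ![0, 0, 0, 1]]]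

/-- The algebra `Q₂(1/3)ˣ ⊕ ⟨𝟙⟩` (over a field of characteristic `5`). -/
abbrev QX : Type u := TableAlgebra (qxTable F)

variable {F}

/-! ### Isomorphisms of algebras with two chosen generating axes -/

/-- There is an isomorphism of `F`-algebras `A → B` that maps `p` to `p'` and `q` to `q'`. -/
def IsoAxes (F : Type u) [Field F] {A : Type v} {B : Type w} [NonUnitalNonAssocRing A] [Module F A]
    [NonUnitalNonAssocRing B] [Module F B] (p q : A) (p' q' : B) : Prop :=
  ∃ f : A →ₙₐ[F] B, Function.Bijective f ∧ f p = p' ∧ f q = q'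

/-- `A` with the axes `p, q` is isomorphic to `3C(α, 1 - α)`. For `α ≠ -1` the latter is `3C(α)` with
the `M(α, 1 - α)`-axes `𝟙 - x` and `y`; for `α = -1` it is `3C(2)`, with basis `u, v, w` of
idempotents, and the `M(-1, 2)`-axes `w` and `𝟙 - u`. -/
def IsThreeC {A : Type v} [NonUnitalNonAssocRing A] [Module F A] (α : F) (p q : A) : Prop :=
  (α ≠ -1 ∧ IsoAxes F p q (threeCOne F α - e (threeCTable F α) 0) (e (threeCTable F α) 1)) ∨
  (α = -1 ∧ IsoAxes F p q (e (threeCTable F 2) 2) (threeCOne F 2 - e (threeCTable F 2) 0))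

/-- `A` with the axes `p, q` is isomorphic to `Q₂(1/3, 2/3)`, that is, to `Q₂(1/3)` with the
`M(1/3, 2/3)`-axes `t₁ = 𝟙 - d₁` and `s₁`. -/
def IsQ (F : Type u) [Field F] {A : Type v} [NonUnitalNonAssocRing A] [Module F A]
    (p q : A) : Prop :=
  IsoAxes F p q (qOne F - e (qTable F) 2) (e (qTable F) 0)

/-- `A` with the axes `p, q` is isomorphic to `Q₂(1/3)ˣ ⊕ ⟨𝟙⟩` with the `M(1/3, 2/3)`-axes
`𝟙 - z` and `x`. -/
def IsQX (F : Type u) [Field F] {A : Type v} [NonUnitalNonAssocRing A] [Module F A]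
    (p q : A) : Prop :=
  IsoAxes F p q (e (qxTable F) 3 - e (qxTable F) 2) (e (qxTable F) 0)

end Examples

end Axial

/-! Write q = l p + u + v + w along the eigenvalues 1, 0, α, β of p, and let m be the coefficient of
q in the decomposition of p along q. If w = 0, both generators lie in A_{0,1,α}(p), which is a
subalgebra, so p is of Jordan type (`IsAxis.jordan_of_generator_mem`).

In general there are four identities: q² = q; q(qp) = α qp + (1 - α)m q; and two extracted from p² =
p as seen by q, namely 2b² = 2pb - b and q b² = (m - m²) q, where b is the A_α(q)-part of p. The
fusion law of p places the products of u, v, w in sums of eigenspaces of p, so each identity splits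
into four, one for each eigenvalue (`IsComponents.split`). If w ≠ 0, these make uw and vw multiples
of w, and comparing the coefficients of p and w gives polynomial equations in α, β, l, m
(`IsComponents.scalars`).

If v = 0, the equations force α + β = 1 and express l and m through α. If v ≠ 0, the A_α(p)-parts
give two more equations, and elimination leaves only (α, β, l, m) = (1/3, 2/3, 5/12, 2/3). In both
cases the nonzero ones among p, u, v, w are linearly independent eigenvectors with a known
multiplication table, and a change to a basis of idempotents identifies A (`isoAxes_of_table`). The
degenerate values α = -1 and characteristic 5, where l = 0, need a different basis. -/

namespace Axial

universe u v w

/-! ## Algebras with a basis that satisfies a multiplication table -/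

section Table

variable {F : Type u} [Field F] {A : Type v} [NonUnitalNonAssocCommRing A] [Module F A]
  [IsScalarTower F A A] [SMulCommClass F A A]

/-- The homomorphism from a table algebra given by elements that satisfy the table. -/
def TableAlgebra.lift {n : ℕ} (c : Fin n → Fin n → Fin n → F) (b : Fin n → A)
    (h : ∀ i j, b i * b j = ∑ k, c i j k • b k) : TableAlgebra c →ₙₐ[F] A where
  toFun x := ∑ i, x i • b i
  map_smul' r x := by
    simp only [TableAlgebra.smul_apply, mul_smul, Finset.smul_sum, MonoidHom.id_apply]
  map_zero' := by
    change ∑ i, (0 : F) • b i = 0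
    simp
  map_add' x y := by
    simp only [TableAlgebra.add_apply, add_smul, Finset.sum_add_distrib]
  map_mul' x y := by
    have hxy : ∀ i j, x i • b i * y j • b j = ∑ k, (x i * y j * c i j k) • b k := by
      intro i j
      rw [smul_mul_assoc, mul_smul_comm, h, smul_smul, Finset.smul_sum]
      simp only [smul_smul]
    simp only [Finset.sum_mul_sum, hxy, TableAlgebra.mul_apply, Finset.sum_smul]
    rw [Finset.sum_comm]
    exact Finset.sum_congr rfl fun i _ => Finset.sum_comm

/-- The family `b` need not be known to span: the range of the lift is a subalgebra containing both
generators, so the lift is onto, and independence makes it injective. The required map is its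
inverse. -/
theorem isoAxes_of_table {n : ℕ} (c : Fin n → Fin n → Fin n → F) (b : Fin n → A)
    (hli : LinearIndependent F b) (h : ∀ i j, b i * b j = ∑ k, c i j k • b k) {p q : A}
    (hgen : NonUnitalAlgebra.adjoin F ({p, q} : Set A) = ⊤) (x y : TableAlgebra c)
    (hp : ∑ i, x i • b i = p) (hq : ∑ i, y i • b i = q) : IsoAxes F p q x y := by
  have hinj : Function.Injective (TableAlgebra.lift c b h) := by
    rw [injective_iff_map_eq_zero]
    intro z hz
    funext i
    exact Fintype.linearIndependent_iff.1 hli z hz i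
  have hsurj : Function.Surjective (TableAlgebra.lift c b h) := by
    have : NonUnitalAlgebra.adjoin F ({p, q} : Set A) ≤
        NonUnitalAlgHom.range (TableAlgebra.lift c b h) := by
      rw [NonUnitalAlgebra.adjoin_le_iff]
      rintro z (rfl | rfl)
      · exact ⟨x, hp⟩
      · exact ⟨y, hq⟩
    intro z
    exact this (hgen ▸ trivial : z ∈ NonUnitalAlgebra.adjoin F ({p, q} : Set A))
  obtain ⟨g, hg1, hg2⟩ := Function.bijective_iff_has_inverse.1 ⟨hinj, hsurj⟩
  refine ⟨(TableAlgebra.lift c b h).inverse g hg1 hg2,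
    Function.bijective_iff_has_inverse.2 ⟨_, hg2, hg1⟩, ?_, ?_⟩
  · rw [← hp]; exact hg1 x
  · rw [← hq]; exact hg1 y

end Table

/-! ## Eigenspaces of an axis -/

section Eigenspaces

variable {F : Type u} [Field F] {A : Type v} [NonUnitalNonAssocCommRing A] [Module F A]
  [SMulCommClass F A A]

theorem mem_axisSpace {a x : A} {t : F} : x ∈ axisSpace F a t ↔ a * x = t • x := by
  rw [axisSpace, Module.End.mem_eigenspace_iff, LinearMap.mulLeft_apply]

theorem axisSum_mono (a : A) {S T : Set F} (h : S ⊆ T) : axisSum F a S ≤ axisSum F a T :=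
  biSup_mono h

theorem axisSum_singleton (a : A) (t : F) : axisSum F a {t} = axisSpace F a t := by
  simp [axisSum]

theorem axisSum_insert (a : A) (t : F) (S : Set F) :
    axisSum F a (insert t S) = axisSpace F a t ⊔ axisSum F a S := by
  rw [axisSum, axisSum, iSup_insert]

theorem mul_mem_of_mem_axisSum [IsScalarTower F A A] {a : A} {S T : Set F} {M : Submodule F A}
    (h : ∀ s ∈ S, ∀ t ∈ T, ∀ x ∈ axisSpace F a s, ∀ y ∈ axisSpace F a t, x * y ∈ M)
    {x y : A} (hx : x ∈ axisSum F a S) (hy : y ∈ axisSum F a T) : x * y ∈ M := by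
  have h1 : ∀ s ∈ S, ∀ x ∈ axisSpace F a s, x * y ∈ M := by
    intro s hs x hx
    have : axisSum F a T ≤ M.comap (LinearMap.mulLeft F x) :=
      iSup₂_le fun t ht z hz => h s hs t ht x hx z hz
    exact this hy
  have : axisSum F a S ≤ M.comap (LinearMap.mulRight F y) :=
    iSup₂_le fun s hs z hz => h1 s hs z hz
  exact this hx

/-- Eigenvectors for the eigenvalues `1, 0, α, β` with sum `0` are `0`. -/
theorem eigen_components {α β : F} (hα0 : α ≠ 0) (hα1 : α ≠ 1) (hβ0 : β ≠ 0) (hβ1 : β ≠ 1)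
    (hαβ : α ≠ β) {a x₁ x₀ xα xβ : A} (h₁ : a * x₁ = x₁) (h₀ : a * x₀ = 0)
    (hα : a * xα = α • xα) (hβ : a * xβ = β • xβ) (h : x₁ + x₀ + xα + xβ = 0) :
    x₁ = 0 ∧ x₀ = 0 ∧ xα = 0 ∧ xβ = 0 := by
  have e1 : x₁ + α • xα + β • xβ = 0 := by
    have := congrArg (a * ·) h
    simpa [mul_add, h₁, h₀, hα, hβ] using this
  have e2 : x₁ + (α * α) • xα + (β * β) • xβ = 0 := by
    have := congrArg (a * ·) e1
    simpa [mul_add, h₁, mul_smul_comm, hα, hβ, smul_smul] using this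
  have e3 : x₁ + (α * α * α) • xα + (β * β * β) • xβ = 0 := by
    have := congrArg (a * ·) e2
    simpa [mul_add, h₁, mul_smul_comm, hα, hβ, smul_smul] using this
  have hβz : xβ = 0 := by
    -- The coefficients come from t³ - (1 + α)t² + αt = t(t - 1)(t - α), which vanishes at 0, 1 and
    -- α.
    have : (β * (β - 1) * (β - α)) • xβ = 0 := by
      linear_combination (norm := module) e3 - (1 + α) • e2 + α • e1
    exact (smul_eq_zero.1 this).resolve_left
      (mul_ne_zero (mul_ne_zero hβ0 (sub_ne_zero.2 hβ1)) (sub_ne_zero.2 hαβ.symm))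
  subst hβz
  have hαz : xα = 0 := by
    have : (α * (α - 1)) • xα = 0 := by
      linear_combination (norm := module) e2 - e1
    exact (smul_eq_zero.1 this).resolve_left (mul_ne_zero hα0 (sub_ne_zero.2 hα1))
  subst hαz
  have h1z : x₁ = 0 := by simpa using e1
  subst h1z
  exact ⟨rfl, by simpa using h, rfl, rfl⟩

end Eigenspaces

/-! ## Axes of Jordan and of Monster type -/

section AxisFacts

variable {F : Type u} [Field F] {A : Type v} [NonUnitalNonAssocCommRing A] [Module F A]
  [SMulCommClass F A A]

theorem axisSum_pair (a : A) (s t : F) :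
    axisSum F a {s, t} = axisSpace F a s ⊔ axisSpace F a t := by
  rw [axisSum_insert, axisSum_singleton]

theorem IsAxis.exists_decomposition_jordan {α : F} {q : A} (hq : IsAxis (jordanLaw α) q) (x : A) :
    ∃ (m : F) (a b : A), q * a = 0 ∧ q * b = α • b ∧ x = m • q + a + b := by
  have hx : x ∈ axisSum F q {0, 1, α} := by
    have := hq.semisimple
    rw [show (jordanLaw α).carrier = {0, 1, α} from rfl] at this
    rw [this]; trivial
  rw [axisSum_insert, axisSum_pair, hq.primitive] at hx
  obtain ⟨a, ha, y, hy, rfl⟩ := Submodule.mem_sup.1 hx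
  obtain ⟨z, hz, b, hb, rfl⟩ := Submodule.mem_sup.1 hy
  obtain ⟨m, rfl⟩ := Submodule.mem_span_singleton.1 hz
  rw [mem_axisSpace] at ha hb
  exact ⟨m, a, b, by simpa using ha, hb, by abel⟩

theorem IsAxis.exists_decomposition_monster {α β : F} {p : A} (hp : IsAxis (monsterLaw α β) p)
    (x : A) : ∃ (l : F) (u v w : A), p * u = 0 ∧ p * v = α • v ∧ p * w = β • w ∧
      x = l • p + u + v + w := by
  have hx : x ∈ axisSum F p {0, 1, α, β} := by
    have := hp.semisimple
    rw [show (monsterLaw α β).carrier = {0, 1, α, β} from rfl] at this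
    rw [this]; trivial
  rw [axisSum_insert, axisSum_insert, axisSum_pair, hp.primitive] at hx
  obtain ⟨u, hu, y, hy, rfl⟩ := Submodule.mem_sup.1 hx
  obtain ⟨z, hz, r, hr, rfl⟩ := Submodule.mem_sup.1 hy
  obtain ⟨v, hv, w, hw, rfl⟩ := Submodule.mem_sup.1 hr
  obtain ⟨l, rfl⟩ := Submodule.mem_span_singleton.1 hz
  rw [mem_axisSpace] at hu hv hw
  exact ⟨l, u, v, w, by simpa using hu, hv, hw, by abel⟩

section Jordan

variable {α : F} {q x y : A}

theorem IsAxis.jordan_zero_mul_zero (hq : IsAxis (jordanLaw α) q) (hx : q * x = 0)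
    (hy : q * y = 0) : q * (x * y) = 0 := by
  have := hq.fusion 0 (by simp [jordanLaw]) 0 (by simp [jordanLaw]) x
    (by simpa [mem_axisSpace] using hx) y (by simpa [mem_axisSpace] using hy)
  simpa [jordanLaw, axisSum_singleton, mem_axisSpace] using this

theorem IsAxis.jordan_zero_mul_eigen (hq : IsAxis (jordanLaw α) q) (hα1 : α ≠ 1)
    (hx : q * x = 0) (hy : q * y = α • y) : q * (x * y) = α • (x * y) := by
  have := hq.fusion 0 (by simp [jordanLaw]) α (by simp [jordanLaw]) x
    (by simpa [mem_axisSpace] using hx) y (by simpa [mem_axisSpace] using hy)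
  simpa [jordanLaw, axisSum_singleton, mem_axisSpace, hα1] using this

theorem IsAxis.jordan_eigen_mul_eigen (hq : IsAxis (jordanLaw α) q) (hα0 : α ≠ 0) (hα1 : α ≠ 1)
    (hx : q * x = α • x) (hy : q * y = α • y) :
    ∃ (c : F) (z : A), q * z = 0 ∧ x * y = c • q + z := by
  have := hq.fusion α (by simp [jordanLaw]) α (by simp [jordanLaw]) x
    (by simpa [mem_axisSpace] using hx) y (by simpa [mem_axisSpace] using hy)
  simp only [jordanLaw, hα0, hα1, if_false, or_self, axisSum_pair, hq.primitive] at this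
  obtain ⟨y', hy', z, hz, h⟩ := Submodule.mem_sup.1 this
  obtain ⟨c, rfl⟩ := Submodule.mem_span_singleton.1 hy'
  exact ⟨c, z, by simpa [mem_axisSpace] using hz, h.symm⟩

end Jordan

section Monster

variable {α β : F} {p x y : A}

theorem IsAxis.monster_zero_mul_zero (hp : IsAxis (monsterLaw α β) p) (hx : p * x = 0)
    (hy : p * y = 0) : p * (x * y) = 0 := by
  have := hp.fusion 0 (by simp [monsterLaw]) 0 (by simp [monsterLaw]) x
    (by simpa [mem_axisSpace] using hx) y (by simpa [mem_axisSpace] using hy)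
  simpa [monsterLaw, axisSum_singleton, mem_axisSpace] using this

theorem IsAxis.monster_zero_mul_alpha (hp : IsAxis (monsterLaw α β) p) (hα1 : α ≠ 1)
    (hx : p * x = 0) (hy : p * y = α • y) : p * (x * y) = α • (x * y) := by
  have := hp.fusion 0 (by simp [monsterLaw]) α (by simp [monsterLaw]) x
    (by simpa [mem_axisSpace] using hx) y (by simpa [mem_axisSpace] using hy)
  simpa [monsterLaw, axisSum_singleton, mem_axisSpace, hα1] using this

theorem IsAxis.monster_zero_mul_beta (hp : IsAxis (monsterLaw α β) p) (hβ1 : β ≠ 1)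
    (hx : p * x = 0) (hy : p * y = β • y) : p * (x * y) = β • (x * y) := by
  have := hp.fusion 0 (by simp [monsterLaw]) β (by simp [monsterLaw]) x
    (by simpa [mem_axisSpace] using hx) y (by simpa [mem_axisSpace] using hy)
  simpa [monsterLaw, axisSum_singleton, mem_axisSpace, hβ1] using this

theorem IsAxis.monster_alpha_mul_beta (hp : IsAxis (monsterLaw α β) p) (hα0 : α ≠ 0)
    (hα1 : α ≠ 1) (hβ0 : β ≠ 0) (hβ1 : β ≠ 1) (hαβ : α ≠ β)
    (hx : p * x = α • x) (hy : p * y = β • y) : p * (x * y) = β • (x * y) := by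
  have := hp.fusion α (by simp [monsterLaw]) β (by simp [monsterLaw]) x
    (by simpa [mem_axisSpace] using hx) y (by simpa [mem_axisSpace] using hy)
  simpa [monsterLaw, axisSum_singleton, mem_axisSpace, hα0, hα1, hβ0, hβ1, hαβ.symm] using this

theorem IsAxis.monster_alpha_mul_alpha (hp : IsAxis (monsterLaw α β) p) (hα0 : α ≠ 0)
    (hα1 : α ≠ 1) (hx : p * x = α • x) (hy : p * y = α • y) :
    ∃ (c : F) (z : A), p * z = 0 ∧ x * y = c • p + z := by
  have := hp.fusion α (by simp [monsterLaw]) α (by simp [monsterLaw]) x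
    (by simpa [mem_axisSpace] using hx) y (by simpa [mem_axisSpace] using hy)
  simp only [monsterLaw, hα0, hα1, if_false, or_self, if_true, axisSum_pair, hp.primitive] at this
  obtain ⟨y', hy', z, hz, h⟩ := Submodule.mem_sup.1 this
  obtain ⟨c, rfl⟩ := Submodule.mem_span_singleton.1 hy'
  exact ⟨c, z, by simpa [mem_axisSpace] using hz, h.symm⟩

theorem IsAxis.monster_beta_mul_beta (hp : IsAxis (monsterLaw α β) p) (hβ0 : β ≠ 0)
    (hβ1 : β ≠ 1) (hαβ : α ≠ β) (hx : p * x = β • x) (hy : p * y = β • y) :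
    ∃ (c : F) (z t : A), p * z = 0 ∧ p * t = α • t ∧ x * y = c • p + z + t := by
  have := hp.fusion β (by simp [monsterLaw]) β (by simp [monsterLaw]) x
    (by simpa [mem_axisSpace] using hx) y (by simpa [mem_axisSpace] using hy)
  simp only [monsterLaw, hβ0, hβ1, hαβ.symm, if_false, if_true, axisSum_insert,
    axisSum_singleton, hp.primitive] at this
  obtain ⟨y', hy', r, hr, h⟩ := Submodule.mem_sup.1 this
  obtain ⟨z, hz, t, ht, rfl⟩ := Submodule.mem_sup.1 hr
  obtain ⟨c, rfl⟩ := Submodule.mem_span_singleton.1 hy'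
  exact ⟨c, z, t, by simpa [mem_axisSpace] using hz, mem_axisSpace.1 ht, by rw [← h, add_assoc]⟩

/-- On `{0, 1, α}` the Monster and the Jordan fusion laws agree. -/
theorem monsterLaw_star_eq (hα0 : α ≠ 0) (hα1 : α ≠ 1) {s t : F}
    (hs : s ∈ (jordanLaw α).carrier) (ht : t ∈ (jordanLaw α).carrier) :
    (monsterLaw α β).star s t = (jordanLaw α).star s t := by
  simp only [jordanLaw, Set.mem_insert_iff, Set.mem_singleton_iff] at hs ht
  rcases hs with rfl | rfl | rfl <;> rcases ht with rfl | rfl | rfl <;>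
    simp [monsterLaw, jordanLaw, hα0, hα1]

theorem jordanLaw_star_subset (hα0 : α ≠ 0) (hα1 : α ≠ 1) {s t : F}
    (hs : s ∈ (jordanLaw α).carrier) (ht : t ∈ (jordanLaw α).carrier) :
    (jordanLaw α).star s t ⊆ (jordanLaw α).carrier := by
  simp only [jordanLaw, Set.mem_insert_iff, Set.mem_singleton_iff] at hs ht
  rcases hs with rfl | rfl | rfl <;> rcases ht with rfl | rfl | rfl <;>
    simp [jordanLaw, hα0, hα1, Set.insert_subset_iff]

theorem jordanLaw_carrier_subset :
    (jordanLaw α).carrier ⊆ (monsterLaw α β).carrier := by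
  simp only [jordanLaw, monsterLaw]
  intro x hx
  simp only [Set.mem_insert_iff, Set.mem_singleton_iff] at hx ⊢
  tauto

/-- If `q` has no component in `A_β(p)`, then `p` is an axis of Jordan type. -/
theorem IsAxis.jordan_of_generator_mem [IsScalarTower F A A] (hp : IsAxis (monsterLaw α β) p) (hα0 : α ≠ 0)
    (hα1 : α ≠ 1) {q : A} (hgen : NonUnitalAlgebra.adjoin F ({p, q} : Set A) = ⊤)
    (hq : q ∈ axisSum F p (jordanLaw α).carrier) : IsAxis (jordanLaw α) p := by
  have hfus : ∀ s ∈ (jordanLaw α).carrier, ∀ t ∈ (jordanLaw α).carrier,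
      ∀ x ∈ axisSpace F p s, ∀ y ∈ axisSpace F p t,
        x * y ∈ axisSum F p ((jordanLaw α).star s t) := by
    intro s hs t ht x hx y hy
    rw [← monsterLaw_star_eq (β := β) hα0 hα1 hs ht]
    exact hp.fusion s (jordanLaw_carrier_subset hs) t (jordanLaw_carrier_subset ht) x hx y hy
  refine ⟨hp.idem, ?_, hfus, hp.primitive⟩
  rw [eq_top_iff]
  rintro x -
  have hx : x ∈ NonUnitalAlgebra.adjoin F ({p, q} : Set A) := hgen ▸ trivial
  -- A_{0,1,α}(p) is closed under products, hence a subalgebra that contains both generators.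
  induction hx using NonUnitalAlgebra.adjoin_induction with
  | mem x hx =>
    rcases hx with rfl | rfl
    · exact (le_biSup (axisSpace F x) (show (1 : F) ∈ (jordanLaw α).carrier by simp [jordanLaw]))
        (mem_axisSpace.2 (by rw [hp.idem, one_smul]))
    · exact hq
  | add x y _ _ hx hy => exact add_mem hx hy
  | zero => exact zero_mem _
  | mul x y _ _ hx hy =>
    exact mul_mem_of_mem_axisSum (fun s hs t ht x hx y hy =>
      axisSum_mono p (jordanLaw_star_subset hα0 hα1 hs ht) (hfus s hs t ht x hx y hy)) hx hy
  | smul r x _ hx => exact Submodule.smul_mem _ r hx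

end Monster

end AxisFacts

/-! ## The components of the second generator -/

section Components

variable {F : Type u} [Field F] {A : Type v} [NonUnitalNonAssocCommRing A] [Module F A]
  [SMulCommClass F A A]

/-- The decomposition `q = l p + u + v + w` of `q` into eigenvectors of the Monster type axis `p`,
together with what the fusion laws of `p` and `q` say about it; `m` is the coefficient of `q` in the
decomposition of `p` into eigenvectors of the Jordan type axis `q`. -/
structure IsComponents (α β l m V W : F) (p q u v w v₀ w₀ y : A) : Prop where
  pp : p * p = p
  pu : p * u = 0
  pv : p * v = α • v
  pw : p * w = β • w
  q_eq : q = l • p + u + v + w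
  puu : p * (u * u) = 0
  puv : p * (u * v) = α • (u * v)
  puw : p * (u * w) = β • (u * w)
  pvw : p * (v * w) = β • (v * w)
  vv : v * v = V • p + v₀
  pv₀ : p * v₀ = 0
  ww : w * w = W • p + w₀ + y
  pw₀ : p * w₀ = 0
  py : p * y = α • y
  qq : q * q = q
  qqp : q * (q * p) = α • (q * p) + ((1 - α) * m) • q
  -- With b the A_α(q)-part of p, `q * p - m • q` is α b; this is 2b² = 2pb - b multiplied by α².
  sq_eq : (2 : F) • ((q * p - m • q) * (q * p - m • q)) =
    α • ((2 : F) • (p * (q * p - m • q)) - (q * p - m • q))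
  -- The second factor is 2α b², and b² has q-part (m - m²) q and otherwise only a part in A_0(q).
  mul_eq : q * ((2 : F) • (p * (q * p - m • q)) - (q * p - m • q)) = (2 * α * (m - m ^ 2)) • q

namespace IsComponents

variable {α β l m V W : F} {p q u v w v₀ w₀ y : A}

theorem q_mul_p (h : IsComponents α β l m V W p q u v w v₀ w₀ y) :
    q * p = l • p + α • v + β • w := by
  rw [mul_comm, h.q_eq]
  simp only [mul_add, mul_smul_comm, h.pp, h.pu, h.pv, h.pw, add_zero]

theorem q_mul_p_sub (h : IsComponents α β l m V W p q u v w v₀ w₀ y) :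
    q * p - m • q = (l - m * l) • p + (-m) • u + (α - m) • v + (β - m) • w := by
  rw [h.q_mul_p, h.q_eq]
  module

theorem two_mul_sub (h : IsComponents α β l m V W p q u v w v₀ w₀ y) :
    (2 : F) • (p * (q * p - m • q)) - (q * p - m • q) =
      (l - m * l) • p + m • u + ((2 * α - 1) * (α - m)) • v + ((2 * β - 1) * (β - m)) • w := by
  rw [h.q_mul_p_sub]
  simp only [mul_add, mul_smul_comm, h.pp, h.pu, h.pv, h.pw]
  module

/-- In `mul_eq`, the second factor is rewritten in terms of q, qp, p and w. The products of q with
the first three are known, which isolates qw. -/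
theorem q_mul_w (h : IsComponents α β l m V W p q u v w v₀ w₀ y) :
    (2 * β * (β - α)) • (q * w) = (m * (2 * α ^ 2 - α + 2 * (1 - 2 * α) * m)) • q -
      (α * (2 * α - 1 - 2 * m) + 2 * l * (1 - α)) • (q * p) := by
  have e := h.mul_eq
  rw [h.two_mul_sub, show (l - m * l) • p + m • u + ((2 * α - 1) * (α - m)) • v +
    ((2 * β - 1) * (β - m)) • w = m • q + (2 * α - 1 - 2 * m) • (q * p) +
      (2 * l * (1 - α)) • p + (2 * β * (β - α)) • w by rw [h.q_mul_p, h.q_eq]; module,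
    mul_add, mul_add, mul_add] at e
  simp only [mul_smul_comm, h.qq, h.qqp] at e
  linear_combination (norm := module) e

theorem split (h : IsComponents α β l m V W p q u v w v₀ w₀ y) (hα0 : α ≠ 0) (hα1 : α ≠ 1)
    (hβ0 : β ≠ 0) (hβ1 : β ≠ 1) (hαβ : α ≠ β) (hp0 : p ≠ 0) (c a₁ a₂ a₃ a₄ b₁ b₂ b₃ c₁ c₂ c₃ : F)
    (h0 : c • p + (a₁ • (u * u) + a₂ • v₀ + a₃ • w₀ + a₄ • u) +
      (b₁ • v + b₂ • (u * v) + b₃ • y) + (c₁ • w + c₂ • (u * w) + c₃ • (v * w)) = 0) :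
    c = 0 ∧ a₁ • (u * u) + a₂ • v₀ + a₃ • w₀ + a₄ • u = 0 ∧
      b₁ • v + b₂ • (u * v) + b₃ • y = 0 ∧ c₁ • w + c₂ • (u * w) + c₃ • (v * w) = 0 := by
  obtain ⟨h1, h2, h3, h4⟩ := eigen_components hα0 hα1 hβ0 hβ1 hαβ (a := p)
    (by rw [mul_smul_comm, h.pp])
    (by simp only [mul_add, mul_smul_comm, h.puu, h.pv₀, h.pw₀, h.pu, smul_zero, add_zero])
    (by simp only [mul_add, mul_smul_comm, h.pv, h.puv, h.py]; module)
    (by simp only [mul_add, mul_smul_comm, h.pw, h.puw, h.pvw]; module) h0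
  exact ⟨(smul_eq_zero.1 h1).resolve_right hp0, h2, h3, h4⟩

end IsComponents

variable [IsScalarTower F A A]

theorem exists_isComponents {α β : F} (hα0 : α ≠ 0) (hα1 : α ≠ 1) (hβ0 : β ≠ 0) (hβ1 : β ≠ 1)
    (hαβ : α ≠ β) {p q : A} (hp : IsAxis (monsterLaw α β) p) (hq : IsAxis (jordanLaw α) q) :
    ∃ (l m V W : F) (u v w v₀ w₀ y : A), IsComponents α β l m V W p q u v w v₀ w₀ y := by
  obtain ⟨l, u, v, w, hu, hv, hw, hqe⟩ := hp.exists_decomposition_monster q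
  obtain ⟨m, a, b, ha, hb, hpe⟩ := hq.exists_decomposition_jordan p
  obtain ⟨V, v₀, hv₀, hvv⟩ := hp.monster_alpha_mul_alpha hα0 hα1 hv hv
  obtain ⟨W, w₀, y, hw₀, hy, hww⟩ := hp.monster_beta_mul_beta hβ0 hβ1 hαβ hw hw
  obtain ⟨c, z, hz, hbb⟩ := hq.jordan_eigen_mul_eigen hα0 hα1 hb hb
  have haa := hq.jordan_zero_mul_zero ha ha
  have hab := hq.jordan_zero_mul_eigen hα1 ha hb
  have hqp : q * p = m • q + α • b := by
    rw [hpe, mul_add, mul_add, mul_smul_comm, hq.idem, ha, hb, add_zero]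
  have hx : q * p - m • q = α • b := by rw [hqp]; abel
  have haq : a * q = 0 := by rw [mul_comm, ha]
  have hbq : b * q = α • b := by rw [mul_comm, hb]
  have hba : b * a = a * b := mul_comm b a
  have hpp : m ^ 2 • q + (2 * m * α) • b + a * a + (2 : F) • (a * b) + (c • q + z) =
      m • q + a + b := by
    have h := hp.idem
    rw [hpe] at h
    simp only [mul_add, add_mul, smul_mul_assoc, mul_smul_comm, hq.idem, ha, hb, haq, hbq, hba,
      hbb] at h
    linear_combination (norm := module) h
  -- The parts of p² = p for the eigenvalues 1, 0, α of q; the β slot is filled with 0. The first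
  -- gives c q = (m - m²) q, the last 2ab = (1 - 2mα) b.
  obtain ⟨h1, h0, hα, -⟩ := eigen_components (F := F) hα0 hα1 hβ0 hβ1 hαβ (a := q)
    (x₁ := (m ^ 2 + c - m) • q) (x₀ := a * a + z - a)
    (xα := (2 * m * α - 1) • b + (2 : F) • (a * b)) (xβ := 0)
    (by rw [mul_smul_comm, hq.idem]) (by rw [mul_sub, mul_add, haa, hz, ha]; simp)
    (by rw [mul_add, mul_smul_comm, mul_smul_comm, hb, hab]; module) (by simp)
    (by linear_combination (norm := module) hpp)
  have hpb : p * b = (m * α) • b + a * b + (c • q + z) := by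
    rw [← hbb]
    conv_lhs => rw [hpe]
    rw [add_mul, add_mul, smul_mul_assoc, hb, smul_smul]
  have hbb2 : (2 : F) • (p * b) - b = (2 : F) • (c • q + z) := by
    rw [hpb]
    linear_combination (norm := module) hα
  have hpx : (2 : F) • (p * (q * p - m • q)) - (q * p - m • q) = (2 * α) • (c • q + z) := by
    rw [hx, mul_smul_comm]
    linear_combination (norm := module) α • hbb2
  refine ⟨l, m, V, W, u, v, w, v₀, w₀, y, hp.idem, hu, hv, hw, hqe,
    hp.monster_zero_mul_zero hu hu, hp.monster_zero_mul_alpha hα1 hu hv,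
    hp.monster_zero_mul_beta hβ1 hu hw, hp.monster_alpha_mul_beta hα0 hα1 hβ0 hβ1 hαβ hv hw,
    hvv, hv₀, hww, hw₀, hy, hq.idem, ?_, ?_, ?_⟩
  · rw [hqp, mul_add, mul_smul_comm, mul_smul_comm, hq.idem, hb]
    module
  · rw [hpx, hx, smul_mul_assoc, mul_smul_comm, hbb]
    module
  · rw [hpx, mul_smul_comm, mul_add, mul_smul_comm, hq.idem, hz]
    linear_combination (norm := module) (2 * α) • h1

/-! ### Eigenspace parts of the four identities -/

namespace IsComponents

variable {α β l m V W : F} {p q u v w v₀ w₀ y : A}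

/-- The four groups on the right lie in A_1(p), A_0(p), A_α(p), A_β(p), ready for `split`. -/
theorem mul_eq_sum (h : IsComponents α β l m V W p q u v w v₀ w₀ y) (a b c d a' b' c' d' : F) :
    (a • p + b • u + c • v + d • w) * (a' • p + b' • u + c' • v + d' • w) =
      (a * a' + c * c' * V + d * d' * W) • p +
      ((b * b') • (u * u) + (c * c') • v₀ + (d * d') • w₀) +
      ((α * (a * c' + c * a')) • v + (b * c' + c * b') • (u * v) + (d * d') • y) +
      ((β * (a * d' + d * a')) • w + (b * d' + d * b') • (u * w) +
        (c * d' + d * c') • (v * w)) := by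
  have hup : u * p = 0 := by rw [mul_comm, h.pu]
  have hvp : v * p = α • v := by rw [mul_comm, h.pv]
  have hwp : w * p = β • w := by rw [mul_comm, h.pw]
  simp only [mul_add, add_mul, smul_mul_assoc, mul_smul_comm, h.pp, h.pu, h.pv, h.pw, hup, hvp,
    hwp, mul_comm v u, mul_comm w u, mul_comm w v, h.vv, h.ww]
  module

theorem components_qq (h : IsComponents α β l m V W p q u v w v₀ w₀ y) (hα0 : α ≠ 0) (hα1 : α ≠ 1)
    (hβ0 : β ≠ 0) (hβ1 : β ≠ 1) (hαβ : α ≠ β) (hp0 : p ≠ 0) :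
    l ^ 2 + V + W = l ∧ u * u + v₀ + w₀ = u ∧ (2 * l * α) • v + (2 : F) • (u * v) + y = v ∧
      (2 * l * β) • w + (2 : F) • (u * w) + (2 : F) • (v * w) = w := by
  have e := h.mul_eq_sum l 1 1 1 l 1 1 1
  simp only [one_smul, ← h.q_eq, h.qq] at e
  rw [h.q_eq] at e
  obtain ⟨h1, h2, h3, h4⟩ := h.split hα0 hα1 hβ0 hβ1 hαβ hp0 (l ^ 2 + V + W - l) 1 1 1 (-1)
    (2 * l * α - 1) 2 1 (2 * l * β - 1) 2 2 (by linear_combination (norm := module) -e)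
  exact ⟨by linear_combination h1, by linear_combination (norm := module) h2,
    by linear_combination (norm := module) h3, by linear_combination (norm := module) h4⟩

theorem components_qqp (h : IsComponents α β l m V W p q u v w v₀ w₀ y) (hα0 : α ≠ 0)
    (hα1 : α ≠ 1) (hβ0 : β ≠ 0) (hβ1 : β ≠ 1) (hαβ : α ≠ β) (hp0 : p ≠ 0) :
    l ^ 2 + α * V + β * W = α * l + (1 - α) * m * l ∧
      α • v₀ + β • w₀ = ((1 - α) * m) • u ∧
      (l * α ^ 2 + α * l) • v + α • (u * v) + β • y = (α ^ 2 + (1 - α) * m) • v ∧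
      (l * β ^ 2 + l * β) • w + β • (u * w) + (α + β) • (v * w) =
        (α * β + (1 - α) * m) • w := by
  have e := h.mul_eq_sum l 1 1 1 l 0 α β
  simp only [one_smul, ← h.q_eq, zero_smul, add_zero, ← h.q_mul_p, h.qqp] at e
  rw [h.q_mul_p, h.q_eq] at e
  obtain ⟨h1, h2, h3, h4⟩ := h.split hα0 hα1 hβ0 hβ1 hαβ hp0
    (l ^ 2 + α * V + β * W - α * l - (1 - α) * m * l) 0 α β (-((1 - α) * m))
    (l * α ^ 2 + α * l - α ^ 2 - (1 - α) * m) α β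
    (l * β ^ 2 + l * β - α * β - (1 - α) * m) β (α + β) (by linear_combination (norm := module) -e)
  exact ⟨by linear_combination h1, by linear_combination (norm := module) h2,
    by linear_combination (norm := module) h3, by linear_combination (norm := module) h4⟩

/-- Only the A_α(p)- and A_β(p)-parts are kept. The factor β - m, the w-coefficient of `q * p - m •
q`, may vanish; this is the source of the alternative m = β in `scalars`. -/
theorem components_sq (h : IsComponents α β l m V W p q u v w v₀ w₀ y) (hα0 : α ≠ 0)
    (hα1 : α ≠ 1) (hβ0 : β ≠ 0) (hβ1 : β ≠ 1) (hαβ : α ≠ β) (hp0 : p ≠ 0) :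
    (4 * α * (l - m * l) * (α - m)) • v - (4 * m * (α - m)) • (u * v) +
        (2 * (β - m) ^ 2) • y = (α * ((2 * α - 1) * (α - m))) • v ∧
      (β - m) • ((4 * (l - m * l) * β) • w - (4 * m) • (u * w) + (4 * (α - m)) • (v * w)) =
        (β - m) • ((α * (2 * β - 1)) • w) := by
  have e := h.sq_eq
  rw [h.two_mul_sub, h.q_mul_p_sub, h.mul_eq_sum] at e
  obtain ⟨-, -, h3, h4⟩ := h.split hα0 hα1 hβ0 hβ1 hαβ hp0
    (2 * ((l - m * l) ^ 2 + (α - m) ^ 2 * V + (β - m) ^ 2 * W) - α * (l - m * l))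
    (2 * m ^ 2) (2 * (α - m) ^ 2) (2 * (β - m) ^ 2) (-(α * m))
    (4 * α * (l - m * l) * (α - m) - α * ((2 * α - 1) * (α - m))) (-(4 * m * (α - m)))
    (2 * (β - m) ^ 2)
    (4 * (l - m * l) * β * (β - m) - α * ((2 * β - 1) * (β - m))) (-(4 * m * (β - m)))
    (4 * (α - m) * (β - m)) (by linear_combination (norm := module) e)
  exact ⟨by linear_combination (norm := module) h3, by linear_combination (norm := module) h4⟩

theorem components_qw (h : IsComponents α β l m V W p q u v w v₀ w₀ y) (hα0 : α ≠ 0)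
    (hα1 : α ≠ 1) (hβ0 : β ≠ 0) (hβ1 : β ≠ 1) (hαβ : α ≠ β) (hp0 : p ≠ 0) :
    2 * β * (β - α) * W = l * (m * (2 * α ^ 2 - α + 2 * (1 - 2 * α) * m)) -
        l * (α * (2 * α - 1 - 2 * m) + 2 * l * (1 - α)) ∧
      (2 * β * (β - α)) • w₀ = (m * (2 * α ^ 2 - α + 2 * (1 - 2 * α) * m)) • u ∧
      (2 * β * (β - α)) • y = (m * (2 * α ^ 2 - α + 2 * (1 - 2 * α) * m) -
        α * (α * (2 * α - 1 - 2 * m) + 2 * l * (1 - α))) • v ∧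
      (2 * β * (β - α)) • ((l * β) • w + u * w + v * w) =
        (m * (2 * α ^ 2 - α + 2 * (1 - 2 * α) * m) -
          β * (α * (2 * α - 1 - 2 * m) + 2 * l * (1 - α))) • w := by
  have e := h.q_mul_w
  have e1 := h.mul_eq_sum l 1 1 1 0 0 0 1
  simp only [one_smul, ← h.q_eq, zero_smul, zero_add] at e1
  rw [e1, h.q_mul_p, h.q_eq] at e
  generalize m * (2 * α ^ 2 - α + 2 * (1 - 2 * α) * m) = X at *
  generalize α * (2 * α - 1 - 2 * m) + 2 * l * (1 - α) = Y at *
  obtain ⟨h1, h2, h3, h4⟩ := h.split hα0 hα1 hβ0 hβ1 hαβ hp0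
    (2 * β * (β - α) * W - l * X + l * Y) 0 0 (2 * β * (β - α)) (-X)
    (-(X - α * Y)) 0 (2 * β * (β - α)) (2 * β * (β - α) * (l * β) - (X - β * Y)) (2 * β * (β - α))
    (2 * β * (β - α)) (by linear_combination (norm := module) e)
  exact ⟨by linear_combination h1, by linear_combination (norm := module) h2,
    by linear_combination (norm := module) h3, by linear_combination (norm := module) h4⟩

end IsComponents

end Components

/-! ### Polynomial equations for α, β, l, m -/

section Scalars

variable {F : Type u} [Field F] {α β l m : F}

theorem scalars_of_ne (hF : (2 : F) ≠ 0) (hβ0 : β ≠ 0) (hαβ : α ≠ β)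
    (hL : β * (β - α) = m * (2 * α ^ 2 - α + 2 * (1 - 2 * α) * m) -
      β * (α * (2 * α - 1 - 2 * m) + 2 * l * (1 - α)))
    (hE : 2 * β * (1 - α) * (m - l) = m * (2 * α ^ 2 - α + 2 * (1 - 2 * α) * m) -
      (α * (2 * α - 1 - 2 * m) + 2 * l * (1 - α)))
    (hM : 2 * (1 - 2 * α) * m = 2 * β * (1 - α) - α) : α + β = 1 := by
  have h12 : 1 - 2 * α ≠ 0 := by grind
  have : (β - α) ^ 2 * (α + β - 1) = 0 := by grind
  grind

/-- The parameters when `q` has no component in `A_α(p)`. -/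
theorem scalars_of_alpha_part_eq_zero (hF : (2 : F) ≠ 0) (hα0 : α ≠ 0) (hα1 : α ≠ 1) (hβ0 : β ≠ 0)
    (hβ1 : β ≠ 1) (hαβ : α ≠ β)
    (hL : β * (β - α) = m * (2 * α ^ 2 - α + 2 * (1 - 2 * α) * m) -
      β * (α * (2 * α - 1 - 2 * m) + 2 * l * (1 - α)))
    (hE : l = 0 ∨ 2 * β * (1 - α) * (m - l) = m * (2 * α ^ 2 - α + 2 * (1 - 2 * α) * m) -
      (α * (2 * α - 1 - 2 * m) + 2 * l * (1 - α)))
    (hM : m = β ∨ 2 * (1 - 2 * α) * m = 2 * β * (1 - α) - α)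
    (hK : 2 * α * β + 2 * (1 - α) * m = 2 * l * β + β) :
    α + β = 1 ∧ 2 * m = 2 - α ∧ 2 * l = 1 + α := by
  rcases hM with rfl | hM
  -- Here `hK` gives l = 1/2, so `hL` becomes (1 - 2α)(β - 1) = 0. With α = 1/2, `hE` then forces β
  -- = 1 or β = α.
  · exfalso
    have hl : 2 * l = 1 := by
      have : m * (2 * l - 1) = 0 := by linear_combination -hK
      grind
    have hα : 2 * α = 1 := by
      have : (2 * α - 1) * (m - 1) = 0 := by grind
      grind
    grind
  · have h12 : 1 - 2 * α ≠ 0 := by grind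
    have hαβ' : α + β = 1 := by
      rcases hE with rfl | hE
      · have : β * (α + β - 1) = 0 := by grind
        grind
      · exact scalars_of_ne hF hβ0 hαβ hL hE hM
    obtain rfl : β = 1 - α := by linear_combination hαβ'
    have hm : 2 * m = 2 - α := by
      have : (1 - 2 * α) * (2 * m - (2 - α)) = 0 := by linear_combination hM
      grind
    refine ⟨hαβ', hm, ?_⟩
    have : (1 - α) * (2 * l - (1 + α)) = 0 := by linear_combination -hK + (1 - α) * hm
    grind

/-- The parameters when `q` has a component in `A_α(p)`. -/
theorem scalars_of_alpha_part_ne_zero (hF : (2 : F) ≠ 0) (hα0 : α ≠ 0) (hβ0 : β ≠ 0)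
    (hβ1 : β ≠ 1) (hαβ : α ≠ β)
    (hL : β * (β - α) = m * (2 * α ^ 2 - α + 2 * (1 - 2 * α) * m) -
      β * (α * (2 * α - 1 - 2 * m) + 2 * l * (1 - α)))
    (hE : l = 0 ∨ 2 * β * (1 - α) * (m - l) = m * (2 * α ^ 2 - α + 2 * (1 - 2 * α) * m) -
      (α * (2 * α - 1 - 2 * m) + 2 * l * (1 - α)))
    (hM : m = β ∨ 2 * (1 - 2 * α) * m = 2 * β * (1 - α) - α)
    (h1 : 4 * α * l = 2 * m + 2 * α ^ 2 - α - β)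
    (h2 : 2 * l * (2 * β - α + α ^ 2) + 2 * m * (α ^ 2 - 2 * β) + 2 * β ^ 2 - α * β -
      2 * α ^ 3 + α ^ 2 = 0) :
    3 * α = 1 ∧ 3 * β = 2 ∧ 3 * m = 2 ∧ 12 * l = 5 := by
  rcases hM with rfl | hM
  · have hL' : 2 * l * (1 - α) = α + m - 2 * α * m :=
      mul_left_cancel₀ hβ0 (by linear_combination hL)
    have hT : m * (1 - 3 * α + 4 * α ^ 2) = α - α ^ 2 + 2 * α ^ 3 := by
      linear_combination 2 * α * hL' - (1 - α) * h1
    have hα : 3 * α = 1 := by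
      -- The case l = 0 is not contradictory: it is compatible with l = 5/12 in characteristic 5.
      rcases hE with rfl | hE
      · obtain rfl : m = α - 2 * α ^ 2 := by linear_combination -h1
        have h12 : 1 - 2 * α ≠ 0 := fun h => hβ0 (by linear_combination α * h)
        have : (2 * α ^ 2 * (1 - 2 * α)) * (3 * α) = (2 * α ^ 2 * (1 - 2 * α)) * 1 := by
          linear_combination h2
        exact mul_left_cancel₀ (mul_ne_zero (mul_ne_zero hF (pow_ne_zero 2 hα0)) h12) this
      · have e1 : m * (1 - 4 * α) + 2 * α ^ 2 = 0 :=
          mul_left_cancel₀ (sub_ne_zero.2 hβ1) (by linear_combination -hE - (m - 1) * hL')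
        exact mul_left_cancel₀ hα0 (by
          linear_combination (1 - 4 * α) * hT - (1 - 3 * α + 4 * α ^ 2) * e1)
    have hm : 3 * m = 2 := by
      have : (2 * 2) * (3 * m) = (2 * 2) * 2 := by
        linear_combination 27 * hT + (27 * m - 36 * m * α - 12 * m - 3 * α + 8 + 18 * α ^ 2) * hα
      exact mul_left_cancel₀ (mul_ne_zero hF hF) this
    refine ⟨hα, hm, hm, ?_⟩
    linear_combination 9 * h1 + 3 * hm + (6 * α - 1 - 12 * l) * hα
  · exfalso
    -- `P1` and `P2` are the consequences in α and β alone, after l and m are eliminated.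
    have P2 : β ^ 2 * (1 - 3 * α) - α * β * (2 - 8 * α + 4 * α ^ 2) - 2 * α ^ 3 * (1 - α) = 0 := by
      linear_combination (1 - 2 * α) * (2 * α * hL - β * (1 - α) * h1 + 2 * α * m * hM) -
        (β * (1 - 3 * α) + 2 * α ^ 2 * (1 - α)) * hM
    have P1 : 2 * β ^ 2 - α * β * (5 - α - 2 * α ^ 2) + 2 * α ^ 2 * (1 - α ^ 2) = 0 := by
      linear_combination 2 * α * h2 - (2 * β - α + α ^ 2) * h1 - (2 * β - α * (1 + α)) * hM
    rcases hE with rfl | hE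
    · obtain rfl : β = 2 * α - 4 * α ^ 2 + 4 * α ^ 3 := by
        linear_combination -hM - (1 - 2 * α) * h1
      have h2α : 2 * α ^ 3 ≠ 0 := mul_ne_zero hF (pow_ne_zero 3 hα0)
      have e2 : 20 * α ^ 3 - 34 * α ^ 2 + 21 * α - 5 = 0 :=
        mul_left_cancel₀ h2α (by linear_combination P1)
      have e3 : 24 * α ^ 4 - 48 * α ^ 3 + 40 * α ^ 2 - 17 * α + 3 = 0 :=
        mul_left_cancel₀ h2α (by linear_combination -P2)
      clear P1 P2 hL hM h1 h2
      have e4 : 32 * α ^ 2 - 43 * α + 15 = 0 :=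
        mul_left_cancel₀ hF (by linear_combination 25 * e3 - 30 * α * e2 + 9 * e2)
      -- The Euclidean algorithm on `e2` and `e3` has to divide by 5. In characteristic 5, `e2`
      -- gives α = -1, which `e3` excludes; otherwise 21α = 17, and `e4` becomes 2⁹ = 0.
      by_cases h5 : (5 : F) = 0
      · have e5 : α + 1 = 0 := mul_left_cancel₀ hα0 (by
          linear_combination e2 - (4 * α ^ 3 - 7 * α ^ 2 + 4 * α - 1) * h5)
        exact hF (by linear_combination e3 - (24 * α ^ 3 - 72 * α ^ 2 + 112 * α - 129) * e5 -
          26 * h5)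
      · have e5 : 21 * α - 17 = 0 := mul_left_cancel₀ (mul_ne_zero h5 h5) (by
          linear_combination 32 * (8 * e2 - 5 * α * e4) + 57 * e4)
        exact pow_ne_zero 9 hF (by linear_combination 441 * e4 - (672 * α - 359) * e5)
    -- Now `P2` is (1 - α)²(1 - 2α)(1 - 3α) = 0, so 3α = 1, and then `P1` reduces to 4 = 0.
    · obtain rfl : β = 1 - α := by linear_combination scalars_of_ne hF hβ0 hαβ hL hE hM
      have h12 : 1 - 2 * α ≠ 0 := fun h => hαβ (by linear_combination -h)
      have e1 : 1 - 3 * α = 0 := mul_left_cancel₀ (mul_ne_zero (pow_ne_zero 2 hβ0) h12)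
        (by linear_combination P2)
      have e2 : 4 * α ^ 3 + 3 * α ^ 2 - 7 * α + 2 = 0 := mul_left_cancel₀ hβ0
        (by linear_combination P1)
      exact mul_ne_zero hF hF (by
        linear_combination 27 * e2 + (36 * α ^ 2 + 39 * α - 50) * e1)

end Scalars

/-! ### Multiplication tables of the components -/

section Relations

variable {F : Type u} [Field F] {A : Type v} [NonUnitalNonAssocCommRing A] [Module F A]

theorem eq_of_smul_eq_smul {a b : F} {x : A} (hx : x ≠ 0) (h : a • x = b • x) : a = b :=
  smul_left_injective F hx h

namespace IsComponents

variable {α β l m V W : F} {p q u v w v₀ w₀ y : A}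

theorem p_ne_zero (h : IsComponents α β l m V W p q u v w v₀ w₀ y) (hβ0 : β ≠ 0) (hw : w ≠ 0) :
    p ≠ 0 := by
  rintro rfl
  have := h.pw
  rw [zero_mul] at this
  exact smul_ne_zero hβ0 hw this.symm

variable [IsScalarTower F A A] [SMulCommClass F A A]

/-- Eliminates uw between the A_β(p)-parts of q² = q and of the identity for q(qp). -/
theorem alpha_smul_v_mul_w (h : IsComponents α β l m V W p q u v w v₀ w₀ y) (hα0 : α ≠ 0)
    (hα1 : α ≠ 1) (hβ0 : β ≠ 0) (hβ1 : β ≠ 1) (hαβ : α ≠ β) (hw : w ≠ 0) :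
    (2 * α) • (v * w) = (2 * α * β + 2 * (1 - α) * m - 2 * l * β - β) • w := by
  obtain ⟨-, -, -, a4⟩ := h.components_qq hα0 hα1 hβ0 hβ1 hαβ (h.p_ne_zero hβ0 hw)
  obtain ⟨-, -, -, b4⟩ := h.components_qqp hα0 hα1 hβ0 hβ1 hαβ (h.p_ne_zero hβ0 hw)
  linear_combination (norm := module) (2 : F) • b4 - β • a4

/-- In order: the w-coefficient of qw against that of q²; the p-coefficients with V and W
eliminated, leaving a factor l; the A_β(p)-part of `sq_eq` with uw and vw eliminated, leaving a
factor β - m. -/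
theorem scalars (h : IsComponents α β l m V W p q u v w v₀ w₀ y) (hα0 : α ≠ 0)
    (hα1 : α ≠ 1) (hβ0 : β ≠ 0) (hβ1 : β ≠ 1) (hαβ : α ≠ β) (hw : w ≠ 0) :
    (β * (β - α) = m * (2 * α ^ 2 - α + 2 * (1 - 2 * α) * m) -
      β * (α * (2 * α - 1 - 2 * m) + 2 * l * (1 - α))) ∧
    (l = 0 ∨ 2 * β * (1 - α) * (m - l) = m * (2 * α ^ 2 - α + 2 * (1 - 2 * α) * m) -
      (α * (2 * α - 1 - 2 * m) + 2 * l * (1 - α))) ∧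
    (m = β ∨ 2 * (1 - 2 * α) * m = 2 * β * (1 - α) - α) := by
  have hp0 := h.p_ne_zero hβ0 hw
  obtain ⟨a1, -, -, a4⟩ := h.components_qq hα0 hα1 hβ0 hβ1 hαβ hp0
  obtain ⟨b1, -, -, -⟩ := h.components_qqp hα0 hα1 hβ0 hβ1 hαβ hp0
  obtain ⟨-, c4⟩ := h.components_sq hα0 hα1 hβ0 hβ1 hαβ hp0
  obtain ⟨d1, -, -, d4⟩ := h.components_qw hα0 hα1 hβ0 hβ1 hαβ hp0
  have hvw := h.alpha_smul_v_mul_w hα0 hα1 hβ0 hβ1 hαβ hw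
  refine ⟨eq_of_smul_eq_smul hw ?_, ?_, ?_⟩
  · linear_combination (norm := module) d4 - (β * (β - α)) • a4
  · rw [or_iff_not_imp_left]
    intro hl
    refine mul_left_cancel₀ hl ?_
    linear_combination d1 - 2 * β * b1 + 2 * β * α * a1
  · rw [or_iff_not_imp_left]
    intro hm
    refine mul_left_cancel₀ (sub_ne_zero.2 (Ne.symm hm)) (eq_of_smul_eq_smul hw ?_)
    linear_combination (norm := module) c4 + (2 * m * (β - m)) • a4 - (2 * (β - m)) • hvw

/-- The multiplication of the components of `q` when the component in `A_α(p)` is zero. -/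
theorem relations_of_eq_zero (h : IsComponents α β l m V W p q u v w v₀ w₀ y)
    (hF : (2 : F) ≠ 0) (hα0 : α ≠ 0) (hα1 : α ≠ 1) (hβ0 : β ≠ 0) (hβ1 : β ≠ 1) (hαβ : α ≠ β)
    (hw : w ≠ 0) (hv : v = 0) :
    α + β = 1 ∧ q = ((1 + α) / 2) • p + u + w ∧ u * u = (α / 2) • u ∧ u * w = (α ^ 2 / 2) • w ∧
      w * w = ((1 - α ^ 2) / 4) • p + (1 - α / 2) • u := by
  have hp0 := h.p_ne_zero hβ0 hw
  obtain ⟨a1, a2, -, a4⟩ := h.components_qq hα0 hα1 hβ0 hβ1 hαβ hp0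
  obtain ⟨-, b2, -, -⟩ := h.components_qqp hα0 hα1 hβ0 hβ1 hαβ hp0
  obtain ⟨-, -, d3, -⟩ := h.components_qw hα0 hα1 hβ0 hβ1 hαβ hp0
  have hvw := h.alpha_smul_v_mul_w hα0 hα1 hβ0 hβ1 hαβ hw
  obtain ⟨hL, hE, hM⟩ := h.scalars hα0 hα1 hβ0 hβ1 hαβ hw
  subst hv
  have hK : 2 * α * β + 2 * (1 - α) * m = 2 * l * β + β := by
    refine eq_of_smul_eq_smul hw ?_
    rw [zero_mul, smul_zero] at hvw
    linear_combination (norm := module) -hvw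
  obtain ⟨hs, hm, hl⟩ := scalars_of_alpha_part_eq_zero hF hα0 hα1 hβ0 hβ1 hαβ hL hE hM hK
  -- From v = 0, the two parts V p and v₀ of v² vanish separately.
  obtain ⟨hV, hv₀, -, -⟩ := h.split hα0 hα1 hβ0 hβ1 hαβ hp0 V 0 1 0 0 0 0 0 0 0 0 (by
    have := h.vv
    rw [zero_mul] at this
    linear_combination (norm := module) -this)
  obtain rfl : v₀ = 0 := by simpa using hv₀
  subst hV
  obtain rfl : y = 0 := by
    rw [smul_zero] at d3
    exact (smul_eq_zero.1 d3).resolve_left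
      (mul_ne_zero (mul_ne_zero hF hβ0) (sub_ne_zero.2 hαβ.symm))
  obtain rfl : β = 1 - α := by linear_combination hs
  obtain rfl : m = (2 - α) / 2 := by field_simp; linear_combination hm
  obtain rfl : l = (1 + α) / 2 := by field_simp; linear_combination hl
  obtain rfl : w₀ = (1 - α / 2) • u := by
    refine smul_right_injective A hβ0 ?_
    change (1 - α) • w₀ = (1 - α) • (1 - α / 2) • u
    linear_combination (norm := skip) b2
    match_scalars <;> field_simp <;> ring
  have h4 : (4 : F) ≠ 0 := by
    rw [show (4 : F) = 2 * 2 by norm_num]; exact mul_ne_zero hF hF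
  refine ⟨hs, by rw [h.q_eq, add_zero], ?_, ?_, ?_⟩
  · linear_combination (norm := skip) a2
    match_scalars <;> field_simp <;> ring
  · rw [zero_mul, smul_zero, add_zero] at a4
    refine smul_right_injective A hF ?_
    change (2 : F) • (u * w) = (2 : F) • (α ^ 2 / 2) • w
    linear_combination (norm := skip) a4
    match_scalars <;> field_simp <;> ring
  · obtain rfl : W = (1 - α ^ 2) / 4 := by
      field_simp at a1 ⊢
      linear_combination a1
    rw [h.ww, add_zero]

/-- The multiplication of the components of `q` when the component in `A_α(p)` is not zero. -/
theorem relations_of_ne_zero (h : IsComponents α β l m V W p q u v w v₀ w₀ y)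
    (hF : (2 : F) ≠ 0) (hα0 : α ≠ 0) (hα1 : α ≠ 1) (hβ0 : β ≠ 0) (hβ1 : β ≠ 1) (hαβ : α ≠ β)
    (hw : w ≠ 0) (hv : v ≠ 0) :
    3 * α = 1 ∧ 3 * β = 2 ∧ q = (5 / 12 : F) • p + u + v + w ∧ u * u = (1 / 6 : F) • u ∧
      u * v = (1 / 9 : F) • v ∧ u * w = (1 / 18 : F) • w ∧ v * w = (1 / 6 : F) • w ∧
      v * v = (5 / 144 : F) • p + (1 / 3 : F) • u ∧
      w * w = (5 / 24 : F) • p + (1 / 2 : F) • u + (1 / 2 : F) • v := by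
  have hp0 := h.p_ne_zero hβ0 hw
  obtain ⟨a1, a2, a3, a4⟩ := h.components_qq hα0 hα1 hβ0 hβ1 hαβ hp0
  obtain ⟨b1, b2, b3, -⟩ := h.components_qqp hα0 hα1 hβ0 hβ1 hαβ hp0
  obtain ⟨c3, -⟩ := h.components_sq hα0 hα1 hβ0 hβ1 hαβ hp0
  obtain ⟨d1, d2, d3, -⟩ := h.components_qw hα0 hα1 hβ0 hβ1 hαβ hp0
  have hvw := h.alpha_smul_v_mul_w hα0 hα1 hβ0 hβ1 hαβ hw
  obtain ⟨hL, hE, hM⟩ := h.scalars hα0 hα1 hβ0 hβ1 hαβ hw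
  have hy : (2 * β) • y = (β + (α * (2 * α - 1 - 2 * m) + 2 * l * (1 - α))) • v := by
    refine smul_right_injective A (sub_ne_zero.2 hαβ.symm) ?_
    change (β - α) • (2 * β) • y = (β - α) • _
    linear_combination (norm := module) d3 - hL • v
  -- The A_α(p)-parts of q² = q and of q(qp), with uv eliminated, give y as a multiple of v a second
  -- time; this is the comparison with `hy`.
  have hZ : (2 * β - α) * (β + (α * (2 * α - 1 - 2 * m) + 2 * l * (1 - α))) =
      2 * β * (2 * α ^ 2 - α - 2 * α * l + 2 * (1 - α) * m) := by
    refine eq_of_smul_eq_smul hv ?_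
    linear_combination (norm := module) (2 * β) • ((2 : F) • b3 - α • a3) - (2 * β - α) • hy
  have h2 : 2 * l * (2 * β - α + α ^ 2) + 2 * m * (α ^ 2 - 2 * β) + 2 * β ^ 2 - α * β -
      2 * α ^ 3 + α ^ 2 = 0 := by linear_combination hZ
  have h1 : 4 * α * l = 2 * m + 2 * α ^ 2 - α - β := by
    -- The A_α(p)-part of `sq_eq`, with uv eliminated by `a3` and y by `hy`.
    have hZ1 : 2 * β * (4 * α * (l - m * l) * (α - m) - 2 * m * (α - m) * (1 - 2 * l * α) -
        α * (2 * α - 1) * (α - m)) + (2 * m * (α - m) + 2 * (β - m) ^ 2) *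
          (β + (α * (2 * α - 1 - 2 * m) + 2 * l * (1 - α))) = 0 := by
      refine eq_of_smul_eq_smul hv ?_
      linear_combination (norm := module) (2 * β) • c3 + (4 * β * m * (α - m)) • a3 -
        (2 * m * (α - m) + 2 * (β - m) ^ 2) • hy
    refine mul_left_cancel₀ (mul_ne_zero (mul_ne_zero hF hα0) hβ0) ?_
    linear_combination hZ1 + 2 * m * hZ - 2 * β * hL
  obtain ⟨h3α, h3β, h3m, h12l⟩ := scalars_of_alpha_part_ne_zero hF hα0 hβ0 hβ1 hαβ hL hE hM h1 h2
  have h3 : (3 : F) ≠ 0 := by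
    intro h0
    rw [h0, zero_mul] at h3α
    exact zero_ne_one h3α
  have h4 : (4 : F) ≠ 0 := by
    rw [show (4 : F) = 2 * 2 by norm_num]; exact mul_ne_zero hF hF
  have h12 : (12 : F) ≠ 0 := by
    rw [show (12 : F) = 2 * 2 * 3 by norm_num]; exact mul_ne_zero (mul_ne_zero hF hF) h3
  have h6 : (6 : F) ≠ 0 := by
    rw [show (6 : F) = 2 * 3 by norm_num]; exact mul_ne_zero hF h3
  have h9 : (9 : F) ≠ 0 := by
    rw [show (9 : F) = 3 * 3 by norm_num]; exact mul_ne_zero h3 h3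
  have h18 : (18 : F) ≠ 0 := by
    rw [show (18 : F) = 2 * 9 by norm_num]; exact mul_ne_zero hF h9
  have h24 : (24 : F) ≠ 0 := by
    rw [show (24 : F) = 2 * 12 by norm_num]; exact mul_ne_zero hF h12
  have h144 : (144 : F) ≠ 0 := by
    rw [show (144 : F) = 12 * 12 by norm_num]; exact mul_ne_zero h12 h12
  obtain rfl : α = 1 / 3 := by field_simp; linear_combination h3α
  obtain rfl : β = 2 / 3 := by field_simp; linear_combination h3β
  obtain rfl : m = 2 / 3 := by field_simp; linear_combination h3m
  obtain rfl : l = 5 / 12 := by field_simp; linear_combination h12l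
  have hw₀ : w₀ = (1 / 2 : F) • u := by
    linear_combination (norm := skip) (9 / 4 : F) • d2
    match_scalars <;> field_simp <;> ring
  have hv₀ : v₀ = (1 / 3 : F) • u := by
    linear_combination (norm := skip) (3 : F) • b2 - (2 : F) • hw₀
    match_scalars <;> field_simp <;> ring
  have hy' : y = (1 / 2 : F) • v := by
    linear_combination (norm := skip) (3 / 4 : F) • hy
    match_scalars <;> field_simp <;> ring
  have hvw' : v * w = (1 / 6 : F) • w := by
    linear_combination (norm := skip) (3 / 2 : F) • hvw
    match_scalars <;> field_simp <;> ring
  have hW : W = 5 / 24 := by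
    linear_combination (norm := skip) (9 / 4 : F) * d1
    field_simp
    ring
  refine ⟨h3α, h3β, h.q_eq, ?_, ?_, ?_, hvw', ?_, ?_⟩
  · linear_combination (norm := skip) a2 - hv₀ - hw₀
    match_scalars <;> field_simp <;> ring
  · linear_combination (norm := skip) (1 / 2 : F) • a3 - (1 / 2 : F) • hy'
    match_scalars <;> field_simp <;> ring
  · linear_combination (norm := skip) (1 / 2 : F) • a4 - hvw'
    match_scalars <;> field_simp <;> ring
  · rw [h.vv, hv₀, show V = 5 / 144 by
      linear_combination (norm := skip) a1 - hW
      field_simp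
      ring]
  · rw [h.ww, hw₀, hW, hy']

end IsComponents

end Relations

open TableAlgebra

/-! ### Idempotent bases and the identification of A -/

section Isomorphisms

variable {F : Type u} [Field F] {A : Type v} [NonUnitalNonAssocCommRing A] [Module F A]
  [IsScalarTower F A A] [SMulCommClass F A A]

theorem isThreeC_of_relations {α : F} (hF : (2 : F) ≠ 0) (hα0 : α ≠ 0) (hα1 : α ≠ 1)
    (hα : α ≠ 1 - α) {p q u w : A} (hp0 : p ≠ 0) (hu0 : u ≠ 0) (hw0 : w ≠ 0) (pp : p * p = p)
    (pu : p * u = 0) (pw : p * w = (1 - α) • w) (hq : q = ((1 + α) / 2) • p + u + w)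
    (uu : u * u = (α / 2) • u) (uw : u * w = (α ^ 2 / 2) • w)
    (ww : w * w = ((1 - α ^ 2) / 4) • p + (1 - α / 2) • u)
    (hgen : NonUnitalAlgebra.adjoin F ({p, q} : Set A) = ⊤) : IsThreeC α p q := by
  have up : u * p = 0 := by rw [mul_comm, pu]
  have wp : w * p = (1 - α) • w := by rw [mul_comm, pw]
  have wu : w * u = (α ^ 2 / 2) • w := by rw [mul_comm, uw]
  have h4 : (4 : F) ≠ 0 := by
    rw [show (4 : F) = 2 * 2 by norm_num]; exact mul_ne_zero hF hF
  have hindep : ∀ a b c : F, a • p + b • u + c • w = 0 → a = 0 ∧ b = 0 ∧ c = 0 := by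
    intro a b c h
    obtain ⟨h1, h2, -, h3⟩ := eigen_components (a := p) hα0 hα1 (sub_ne_zero.2 hα1.symm)
      (fun h => hα0 (by linear_combination -h)) hα (x₁ := a • p) (x₀ := b • u) (xα := 0)
      (xβ := c • w) (by rw [mul_smul_comm, pp]) (by rw [mul_smul_comm, pu, smul_zero])
      (by simp) (by rw [mul_smul_comm, pw, smul_comm]) (by rw [add_zero]; exact h)
    exact ⟨(smul_eq_zero.1 h1).resolve_right hp0, (smul_eq_zero.1 h2).resolve_right hu0,
      (smul_eq_zero.1 h3).resolve_right hw0⟩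
  by_cases hα' : α = -1
  · right
    refine ⟨hα', ?_⟩
    subst hα'
    have h3 : (3 : F) ≠ 0 := fun h => hα (by linear_combination -h)
    -- Here q = u + w has no p-part, and the identity is 𝟙 = p - 2u. The basis is 𝟙 - q, its image
    -- under w ↦ -w, and p.
    refine isoAxes_of_table (threeCTable F 2) ![p - (3 : F) • u - w, p - (3 : F) • u + w, p] ?_ ?_
      hgen _ _ ?_ ?_
    · rw [Fintype.linearIndependent_iff]
      intro g hg
      simp only [Fin.sum_univ_three, Matrix.cons_val] at hg
      obtain ⟨e1, e2, e3⟩ := hindep (g 0 + g 1 + g 2) (-3 * (g 0 + g 1)) (g 1 - g 0)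
        (by linear_combination (norm := module) hg)
      have e4 : g 0 + g 1 = 0 := by
        have := mul_eq_zero.1 e2
        exact this.resolve_left (neg_ne_zero.2 h3)
      have e0 : g 0 = 0 := mul_left_cancel₀ hF (by linear_combination e4 - e3)
      intro i
      fin_cases i
      · exact e0
      · change g 1 = 0
        linear_combination e4 - e0
      · change g 2 = 0
        linear_combination e1 - e4
    · intro i j
      fin_cases i <;> fin_cases j <;>
        simp only [Fin.sum_univ_three, threeCTable, Matrix.cons_val, Fin.zero_eta, Fin.mk_one,
          Fin.reduceFinMk, mul_add, add_mul, mul_sub, sub_mul, smul_mul_assoc,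
          mul_smul_comm, pp, pu, pw, up, wp, uu, uw, wu, ww] <;> match_scalars <;> field_simp <;> ring
    · simp [e_apply]
    · rw [hq]
      simp only [Fin.sum_univ_three, Matrix.cons_val, threeCOne, TableAlgebra.sub_apply,
        TableAlgebra.smul_apply, TableAlgebra.add_apply, e_apply]
      simp only [Fin.isValue, Fin.reduceEq, if_true, if_false]
      have h21 : (2 + 1 : F) ≠ 0 := by norm_num; exact h3
      match_scalars <;> field_simp <;> ring
  · left
    refine ⟨hα', ?_⟩
    have hα1' : α + 1 ≠ 0 := fun h => hα' (by linear_combination h)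
    have hα1'' : 1 + α ≠ 0 := fun h => hα' (by linear_combination h)
    -- The identity is p + (2/α)u, so the basis is 𝟙 - p, q and the image of q under w ↦ -w.
    refine isoAxes_of_table (threeCTable F α) ![(2 / α) • u, ((1 + α) / 2) • p + u + w,
      ((1 + α) / 2) • p + u - w] ?_ ?_ hgen _ _ ?_ ?_
    · rw [Fintype.linearIndependent_iff]
      intro g hg
      simp only [Fin.sum_univ_three, Matrix.cons_val] at hg
      obtain ⟨e1, e2, e3⟩ := hindep ((1 + α) / 2 * (g 1 + g 2)) (2 / α * g 0 + (g 1 + g 2))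
        (g 1 - g 2) (by linear_combination (norm := module) hg)
      have e4 : g 1 + g 2 = 0 := (mul_eq_zero.1 e1).resolve_left (div_ne_zero hα1'' hF)
      have e5 : g 1 = 0 := mul_left_cancel₀ hF (by linear_combination e4 + e3)
      have e0 : g 0 = 0 := by
        rw [e4, add_zero] at e2
        exact (mul_eq_zero.1 e2).resolve_left (div_ne_zero hF hα0)
      intro i
      fin_cases i
      · exact e0
      · exact e5
      · change g 2 = 0
        linear_combination e4 - e5
    · intro i j
      fin_cases i <;> fin_cases j <;>
        simp only [Fin.sum_univ_three, threeCTable, Matrix.cons_val, Fin.zero_eta, Fin.mk_one,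
          Fin.reduceFinMk, mul_add, add_mul, mul_sub, sub_mul, smul_mul_assoc,
          mul_smul_comm, pp, pu, pw, up, wp, uu, uw, wu, ww] <;> match_scalars <;> field_simp <;> ring
    · simp only [Fin.sum_univ_three, Matrix.cons_val, threeCOne, TableAlgebra.sub_apply,
        TableAlgebra.smul_apply, TableAlgebra.add_apply, e_apply]
      simp only [Fin.isValue, Fin.reduceEq, if_true, if_false]
      match_scalars <;> field_simp <;> ring
    · rw [hq]
      simp [e_apply]

section FourDimensional

variable {p q u v w : A}

/-- The multiplication of the components of `q` in the four-dimensional algebras. -/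
structure IsFourDimensional (F : Type u) [Field F] {A : Type v} [NonUnitalNonAssocCommRing A]
    [Module F A] (p q u v w : A) : Prop where
  indep : ∀ a b c d : F, a • p + b • u + c • v + d • w = 0 → a = 0 ∧ b = 0 ∧ c = 0 ∧ d = 0
  q_eq : q = (5 / 12 : F) • p + u + v + w
  pp : p * p = p
  pu : p * u = 0
  pv : p * v = (1 / 3 : F) • v
  pw : p * w = (2 / 3 : F) • w
  uu : u * u = (1 / 6 : F) • u
  uv : u * v = (1 / 9 : F) • v
  uw : u * w = (1 / 18 : F) • w
  vw : v * w = (1 / 6 : F) • w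
  vv : v * v = (5 / 144 : F) • p + (1 / 3 : F) • u
  ww : w * w = (5 / 24 : F) • p + (1 / 2 : F) • u + (1 / 2 : F) • v

theorem IsFourDimensional.isQ (h : IsFourDimensional F p q u v w) (hF : (2 : F) ≠ 0)
    (h3 : (3 : F) ≠ 0) (h5 : (5 : F) ≠ 0)
    (hgen : NonUnitalAlgebra.adjoin F ({p, q} : Set A) = ⊤) : IsQ F p q := by
  obtain ⟨hindep, hq, pp, pu, pv, pw, uu, uv, uw, vw, vv, ww⟩ := h
  have up : u * p = 0 := by rw [mul_comm, pu]
  have vp : v * p = (1 / 3 : F) • v := by rw [mul_comm, pv]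
  have wp : w * p = (2 / 3 : F) • w := by rw [mul_comm, pw]
  have vu : v * u = (1 / 9 : F) • v := by rw [mul_comm, uv]
  have wu : w * u = (1 / 18 : F) • w := by rw [mul_comm, uw]
  have wv : w * v = (1 / 6 : F) • w := by rw [mul_comm, vw]
  have h4 : (4 : F) ≠ 0 := by
    rw [show (4 : F) = 2 * 2 by norm_num]; exact mul_ne_zero hF hF
  have h12 : (12 : F) ≠ 0 := by
    rw [show (12 : F) = 2 * 2 * 3 by norm_num]; exact mul_ne_zero (mul_ne_zero hF hF) h3
  have h6 : (6 : F) ≠ 0 := by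
    rw [show (6 : F) = 2 * 3 by norm_num]; exact mul_ne_zero hF h3
  have h9 : (9 : F) ≠ 0 := by
    rw [show (9 : F) = 3 * 3 by norm_num]; exact mul_ne_zero h3 h3
  have h18 : (18 : F) ≠ 0 := by
    rw [show (18 : F) = 2 * 9 by norm_num]; exact mul_ne_zero hF h9
  have h24 : (24 : F) ≠ 0 := by
    rw [show (24 : F) = 2 * 12 by norm_num]; exact mul_ne_zero hF h12
  have h144 : (144 : F) ≠ 0 := by
    rw [show (144 : F) = 12 * 12 by norm_num]; exact mul_ne_zero h12 h12
  -- Here s₁ = q, s₂ is its image under w ↦ -w, and d₁ = 𝟙 - p with 𝟙 = p + 6u. Finally d₂ is s₁ +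
  -- s₂ with the sign of v changed.
  refine isoAxes_of_table (qTable F) ![(5 / 12 : F) • p + u + v + w, (5 / 12 : F) • p + u + v - w,
    (6 : F) • u, (5 / 6 : F) • p + (2 : F) • u - (2 : F) • v] ?_ ?_ hgen _ _ ?_ ?_
  · rw [Fintype.linearIndependent_iff]
    intro g hg
    simp only [Fin.sum_univ_four, Matrix.cons_val] at hg
    obtain ⟨e1, e2, e3, e4⟩ := hindep (5 / 12 * (g 0 + g 1 + 2 * g 3))
      (g 0 + g 1 + 6 * g 2 + 2 * g 3) (g 0 + g 1 - 2 * g 3) (g 0 - g 1) (by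
        linear_combination (norm := skip) hg
        match_scalars <;> field_simp <;> ring)
    have e5 : g 0 + g 1 + 2 * g 3 = 0 := (mul_eq_zero.1 e1).resolve_left (div_ne_zero h5 h12)
    have e6 : g 3 = 0 := mul_left_cancel₀ h4 (by linear_combination e5 - e3)
    have e7 : g 2 = 0 := mul_left_cancel₀ h6 (by linear_combination e2 - e5)
    have e8 : g 0 = 0 := mul_left_cancel₀ hF (by linear_combination e5 + e4 - 2 * e6)
    intro i
    fin_cases i
    · exact e8
    · change g 1 = 0
      linear_combination e8 - e4
    · exact e7
    · exact e6
  · intro i j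
    fin_cases i <;> fin_cases j <;>
      simp only [Fin.sum_univ_four, qTable, Matrix.cons_val, Fin.zero_eta, Fin.mk_one,
        Fin.reduceFinMk, mul_add, add_mul, mul_sub, sub_mul, smul_mul_assoc, mul_smul_comm, pp, pu,
        pv, pw, up, vp, wp, uu, uv, uw, vu, vw, wu, wv, vv, ww] <;>
      match_scalars <;> field_simp <;> ring
  · simp only [Fin.sum_univ_four, Matrix.cons_val, qOne, TableAlgebra.sub_apply,
      TableAlgebra.smul_apply, TableAlgebra.add_apply, e_apply]
    simp only [Fin.isValue, Fin.reduceEq, if_true, if_false]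
    match_scalars <;> field_simp <;> ring
  · rw [hq]
    simp [e_apply]

theorem IsFourDimensional.isQX (h : IsFourDimensional F p q u v w) (hF : (2 : F) ≠ 0)
    (h3 : (3 : F) ≠ 0) (h5 : (5 : F) = 0)
    (hgen : NonUnitalAlgebra.adjoin F ({p, q} : Set A) = ⊤) : IsQX F p q := by
  obtain ⟨hindep, hq, pp, pu, pv, pw, uu, uv, uw, vw, vv, ww⟩ := h
  -- All structure constants are reduced modulo 5.
  have c2 : (1 / 3 : F) = 2 := by field_simp; linear_combination -h5
  have c4 : (2 / 3 : F) = 4 := by field_simp; linear_combination -2 * h5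
  have c12 : (5 / 12 : F) = 0 := by rw [h5, zero_div]
  have h6 : (6 : F) ≠ 0 := by
    rw [show (6 : F) = 2 * 3 by norm_num]; exact mul_ne_zero hF h3
  have h9 : (9 : F) ≠ 0 := by
    rw [show (9 : F) = 3 * 3 by norm_num]; exact mul_ne_zero h3 h3
  have h18 : (18 : F) ≠ 0 := by
    rw [show (18 : F) = 2 * 9 by norm_num]; exact mul_ne_zero hF h9
  have c6 : (1 / 6 : F) = 1 := by field_simp; linear_combination -h5
  have c9 : (1 / 9 : F) = 4 := by field_simp; linear_combination -7 * h5
  have c18 : (1 / 18 : F) = 2 := by field_simp; linear_combination -7 * h5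
  have c144 : (5 / 144 : F) = 0 := by rw [h5, zero_div]
  have c24 : (5 / 24 : F) = 0 := by rw [h5, zero_div]
  have ch : (1 / 2 : F) = 3 := by field_simp; linear_combination -h5
  simp only [c2, c4, c12, c6, c9, c18, c144, c24, ch, zero_smul, zero_add, one_smul] at *
  have up : u * p = 0 := by rw [mul_comm, pu]
  have vp : v * p = (2 : F) • v := by rw [mul_comm, pv]
  have wp : w * p = (4 : F) • w := by rw [mul_comm, pw]
  have vu : v * u = (4 : F) • v := by rw [mul_comm, uv]
  have wu : w * u = (2 : F) • w := by rw [mul_comm, uw]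
  have wv : w * v = w := by rw [mul_comm, vw]
  -- In characteristic 5 the p-coefficients 5/12 and 5/6 vanish, so the basis used for `qTable` no
  -- longer spans p. The identity p + 6u = p + u takes the place of d₂.
  refine isoAxes_of_table (qxTable F) ![u + v + w, u + v - w, u, p + u] ?_ ?_ hgen _ _ ?_ ?_
  · rw [Fintype.linearIndependent_iff]
    intro g hg
    simp only [Fin.sum_univ_four, Matrix.cons_val] at hg
    obtain ⟨e1, e2, e3, e4⟩ := hindep (g 3) (g 0 + g 1 + g 2 + g 3) (g 0 + g 1) (g 0 - g 1) (by
      linear_combination (norm := module) hg)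
    have e5 : g 0 = 0 := mul_left_cancel₀ hF (by linear_combination e3 + e4)
    intro i
    fin_cases i
    · exact e5
    · change g 1 = 0
      linear_combination e3 - e5
    · change g 2 = 0
      linear_combination e2 - e3 - e1
    · exact e1
  · intro i j
    fin_cases i <;> fin_cases j <;>
      simp only [Fin.sum_univ_four, qxTable, Matrix.cons_val, Fin.zero_eta, Fin.mk_one,
        Fin.reduceFinMk, mul_add, add_mul, mul_sub, sub_mul, pp, pu,
        pv, pw, up, vp, wp, uu, uv, uw, vu, vw, wu, wv, vv, ww]
    all_goals match_scalars <;> grind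
  · simp only [Fin.sum_univ_four, Matrix.cons_val, TableAlgebra.sub_apply, e_apply]
    simp only [Fin.isValue, Fin.reduceEq, if_true, if_false]
    module
  · rw [hq]
    simp [e_apply]

end FourDimensional

end Isomorphisms

end Axial

/-! ### Case distinction on the vanishing of w and v -/

theorem mainTheorem2 {F : Type*} [Field F] (hF : ringChar F ≠ 2)
    {A : Type*} [NonUnitalNonAssocCommRing A] [Module F A]
    [IsScalarTower F A A] [SMulCommClass F A A]
    (α β : F) (hα0 : α ≠ 0) (hα1 : α ≠ 1) (hβ0 : β ≠ 0) (hβ1 : β ≠ 1) (hαβ : α ≠ β)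
    (p q : A) (hp : Axial.IsAxis (Axial.monsterLaw α β) p)
    (hq : Axial.IsAxis (Axial.jordanLaw α) q)
    (hgen : NonUnitalAlgebra.adjoin F ({p, q} : Set A) = ⊤) :
    Axial.IsAxialAlgebra (Axial.jordanLaw α) ({p, q} : Set A) ∨
    (α ≠ 1 / 2 ∧ α + β = 1 ∧ Axial.IsThreeC α p q) ∨
    ((3 : F) ≠ 0 ∧ α = 1 / 3 ∧ β = 2 / 3 ∧
      ((ringChar F ≠ 5 ∧ Axial.IsQ F p q) ∨ (ringChar F = 5 ∧ Axial.IsQX F p q))) := by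
  have h2 : (2 : F) ≠ 0 := Ring.two_ne_zero hF
  obtain ⟨l, m, V, W, u, v, w, v₀, w₀, y, h⟩ :=
    Axial.exists_isComponents hα0 hα1 hβ0 hβ1 hαβ hp hq
  by_cases hw : w = 0
  · left
    have hqJ : q ∈ Axial.axisSum F p (Axial.jordanLaw α).carrier := by
      rw [show (Axial.jordanLaw α).carrier = {0, 1, α} from rfl, Axial.axisSum_insert,
        Axial.axisSum_pair, h.q_eq, hw, add_zero]
      refine add_mem (add_mem ?_ ?_) ?_
      · refine Submodule.mem_sup_right (Submodule.mem_sup_left ?_)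
        rw [Axial.mem_axisSpace, mul_smul_comm, h.pp, one_smul]
      · refine Submodule.mem_sup_left ?_
        rw [Axial.mem_axisSpace, h.pu, zero_smul]
      · exact Submodule.mem_sup_right (Submodule.mem_sup_right (Axial.mem_axisSpace.2 h.pv))
    refine ⟨?_, hgen⟩
    rintro a (rfl | rfl)
    · exact hp.jordan_of_generator_mem hα0 hα1 hgen hqJ
    · exact hq
  right
  have hp0 := h.p_ne_zero hβ0 hw
  by_cases hv : v = 0
  · left
    obtain ⟨hs, hqe, uu, uw, ww⟩ := h.relations_of_eq_zero h2 hα0 hα1 hβ0 hβ1 hαβ hw hv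
    obtain rfl : β = 1 - α := by linear_combination hs
    refine ⟨fun hα => hαβ ?_, hs, ?_⟩
    · rw [hα]
      field_simp
      ring
    · refine Axial.isThreeC_of_relations h2 hα0 hα1 hαβ hp0 ?_ hw h.pp h.pu h.pw hqe uu uw ww hgen
      rintro rfl
      rw [zero_mul] at uw
      exact smul_ne_zero (div_ne_zero (pow_ne_zero 2 hα0) h2) hw uw.symm
  · right
    obtain ⟨h3α, h3β, hqe, uu, uv, uw, vw, vv, ww⟩ :=
      h.relations_of_ne_zero h2 hα0 hα1 hβ0 hβ1 hαβ hw hv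
    have h3 : (3 : F) ≠ 0 := by
      intro h0
      rw [h0, zero_mul] at h3α
      exact zero_ne_one h3α
    have hα : α = 1 / 3 := by field_simp; linear_combination h3α
    have hβ : β = 2 / 3 := by field_simp; linear_combination h3β
    have hu : u ≠ 0 := by
      rintro rfl
      rw [zero_mul] at uw
      refine smul_ne_zero (one_div_ne_zero ?_) hw uw.symm
      rw [show (18 : F) = 2 * 3 * 3 by norm_num]
      exact mul_ne_zero (mul_ne_zero h2 h3) h3
    have h4 : Axial.IsFourDimensional F p q u v w := by
      refine ⟨?_, hqe, h.pp, h.pu, hα ▸ h.pv, hβ ▸ h.pw, uu, uv, uw, vw, vv, ww⟩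
      intro a b c d e
      obtain ⟨e1, e2, e3, e4⟩ := Axial.eigen_components hα0 hα1 hβ0 hβ1 hαβ (a := p)
        (by rw [mul_smul_comm, h.pp]) (by rw [mul_smul_comm, h.pu, smul_zero])
        (by rw [mul_smul_comm, h.pv, smul_comm]) (by rw [mul_smul_comm, h.pw, smul_comm]) e
      exact ⟨(smul_eq_zero.1 e1).resolve_right hp0, (smul_eq_zero.1 e2).resolve_right hu,
        (smul_eq_zero.1 e3).resolve_right hv, (smul_eq_zero.1 e4).resolve_right hw⟩
    have h5 : ringChar F = 5 ↔ (5 : F) = 0 := by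
      rw [show (5 : F) = ((5 : ℕ) : F) by norm_num, ringChar.spec]
      refine ⟨fun h => h ▸ dvd_rfl, fun h => ?_⟩
      exact ((Nat.dvd_prime (by norm_num)).1 h).resolve_left CharP.ringChar_ne_one
    refine ⟨h3, hα, hβ, ?_⟩
    by_cases hc : ringChar F = 5
    · exact Or.inr ⟨hc, h4.isQX h2 h3 (h5.1 hc) hgen⟩
    · exact Or.inl ⟨hc, h4.isQ h2 h3 (fun h => hc (h5.2 h)) hgen⟩
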